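/- **Theorem 3.5.** Let $N\ge 2$, let $\Omega\subset\mathbb R^N$ be open and bounded, and let $1<p<N$. Let $a(x,s,\xi)=\tilde a(x,\xi)\,b(s)$, where: * $\tilde a:\Omega\times\mathbb R^N\to\mathbb R^N$ is a Carathéodory function such that, for some $\beta>0$ and some $0\le\ell\in L^{p/(p-1)}(\Omega)$, for a.e. $x\in\Omega$ and all $\xi\ne\xi'$ in $\mathbb R^N$, $$\tilde a(x,\xi)\cdot\xi\ge|\xi|^p,\qquad |\tilde a(x,\xi)|\le\beta\big(\ell(x)+|\xi|^{p-1}\big),\qquad \big(\tilde a(x,\xi)-\tilde a(x,\xi')\big)\cdot(\xi-\xi')>0;$$ * $b:\mathbb R\to\mathbb R$ is bounded and Lipschitz, and $b(s)\ge \alpha(1+|s|)^{-\theta(p-1)}$ for all $s\in\mathbb R$, with constants $\alpha>0$ and $\theta\ge0$. Let $h:[0,\infty)\to[0,\infty]$ be strictly decreasing, continuous and finite on $(0,\infty)$, and suppose that there are $\gamma_2\ge0$ and $c_2,s_2>0$ with $h(s)\le c_2 s^{-\gamma_2}$ for all $s\ge s_2$. Let $m\ge1$ and let $f\in L^m(\Omega)$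 satisfy $f>0$ a.e. in $\Omega$. Consider the problem $$-\operatorname{div}\big(a(x,u,\nabla u)\big)=h(u)f\ \text{ in }\Omega,\qquad u\ge0\ \text{ in }\Omega,\qquad u=0\ \text{ on }\partial\Omega. \tag{P}$$ For $k>0$ let $T_k(s)=\max(-k,\min(s,k))$. If all truncations $T_k(u)$ of a measurable function $u$ are weakly differentiable, $\nabla u$ denotes the a.e. unique measurable function with $\nabla T_k(u)=\nabla u\,\chi_{\{|u|\le k\}}$ a.e. in $\Omega$ for every $k>0$. A nonnegative measurable, a.e. finite function $u$ on $\Omega$ is an *entropy solution* of (P) if, for every $k>0$ and every $\varphi\in W^{1,p}_0(\Omega)\cap L^\infty(\Omega)$, one has $T_k(u)\in W^{1,p}_0(\Omega)$, $a(x,T_k(u),\nabla T_k(u))\in L^{p/(p-1)}(\Omega)^N$, $h(u)f\,T_k(u-\varphi)\in L^1(\Omega)$ and $$\int_\Omega a(x,u,\nabla u)\cdot\nabla T_k(u-\varphi)\,dx\le\int_\Omega h(u)f\,T_k(u-\varphi)\,dx .$$ Then, identifying functions that agree a.e. in $\Omega$: 1. If $\theta\le\frac{\gamma_2}{p-1}$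 and $m=1$, then (P) has at most one entropy solution. 2. If $\theta>\frac{\gamma_2}{p-1}$ and $m>1$, then (P) has at most one entropy solution $u$ such that $u^{\frac{m(\theta(p-1)-\gamma_2)}{m-1}}\in L^1(\Omega)$. 3. If $\theta\le1+\frac{\gamma_2}{p-1}$ and $$m\ge\max\left(\frac{N(p-1)}{(N-p)(\gamma_2-\theta(p-1))+N(p-1)},\,1\right),$$ then (P) has at most one entropy solution. -/

import Mathlib

open MeasureTheory Filter Topology Set
open scoped ENNReal NNReal

noncomputable section

namespace DegElliptic

/-- Truncation at levels `-k` and `k`. -/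
def trunc (k s : ℝ) : ℝ := max (-k) (min s k)

/-- `φ ∈ C_c^∞(Ω)`. -/
structure IsTestFunction {N : ℕ} (Ω : Set (EuclideanSpace ℝ (Fin N)))
    (φ : EuclideanSpace ℝ (Fin N) → ℝ) : Prop where
  smooth : ContDiff ℝ (⊤ : ℕ∞) φ
  compact_support : HasCompactSupport φ
  support_subset : tsupport φ ⊆ Ω

/-- `v ∈ L¹_loc(Ω)` has the distributional gradient `g ∈ L¹_loc(Ω)^N` in the open set `Ω`. -/
structure IsWeakGradient {N : ℕ} (Ω : Set (EuclideanSpace ℝ (Fin N)))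
    (v : EuclideanSpace ℝ (Fin N) → ℝ)
    (g : EuclideanSpace ℝ (Fin N) → EuclideanSpace ℝ (Fin N)) : Prop where
  locInt : LocallyIntegrableOn v Ω volume
  locInt_grad : LocallyIntegrableOn g Ω volume
  integral_eq : ∀ φ : EuclideanSpace ℝ (Fin N) → ℝ, IsTestFunction Ω φ →
    ∫ x in Ω, v x • gradient φ x = - ∫ x in Ω, φ x • g x

open Classical in
/-- The weak gradient of `v` in `Ω` (unique a.e. in `Ω` when it exists; `0` if there is none). -/
def weakGrad {N : ℕ} (Ω : Set (EuclideanSpace ℝ (Fin N)))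
    (v : EuclideanSpace ℝ (Fin N) → ℝ) : EuclideanSpace ℝ (Fin N) → EuclideanSpace ℝ (Fin N) :=
  if hv : ∃ g, IsWeakGradient Ω v g then hv.choose else 0

/-- `v ∈ W₀^{1,p}(Ω)`: the function `v` lies in `W^{1,p}(Ω)` and is the limit, in the norm of
`W^{1,p}(Ω)`, of functions of class `C_c^∞(Ω)`. -/
def MemW01p {N : ℕ} (Ω : Set (EuclideanSpace ℝ (Fin N))) (p : ℝ)
    (v : EuclideanSpace ℝ (Fin N) → ℝ) : Prop :=
  MemLp v (ENNReal.ofReal p) (volume.restrict Ω) ∧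
  ∃ g : EuclideanSpace ℝ (Fin N) → EuclideanSpace ℝ (Fin N),
    IsWeakGradient Ω v g ∧ MemLp g (ENNReal.ofReal p) (volume.restrict Ω) ∧
    ∃ φ : ℕ → EuclideanSpace ℝ (Fin N) → ℝ, (∀ n, IsTestFunction Ω (φ n)) ∧
      Tendsto (fun n => eLpNorm (fun x => φ n x - v x) (ENNReal.ofReal p) (volume.restrict Ω))
        atTop (𝓝 0) ∧
      Tendsto (fun n => eLpNorm (fun x => gradient (φ n) x - g x) (ENNReal.ofReal p)
        (volume.restrict Ω)) atTop (𝓝 0)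

/-- `G` is the generalized gradient in `Ω` of a function `u` all of whose truncations are weakly
differentiable: `G` is measurable and `∇ T_k(u) = G χ_{|u| ≤ k}` for every `k > 0`. -/
def IsGenGradient {N : ℕ} (Ω : Set (EuclideanSpace ℝ (Fin N)))
    (u : EuclideanSpace ℝ (Fin N) → ℝ)
    (G : EuclideanSpace ℝ (Fin N) → EuclideanSpace ℝ (Fin N)) : Prop :=
  AEStronglyMeasurable G (volume.restrict Ω) ∧
  ∀ k : ℝ, 0 < k → IsWeakGradient Ω (fun x => trunc k (u x)) ({x | |u x| ≤ k}.indicator G)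

open Classical in
/-- The generalized gradient `∇u` of `u` in `Ω` (it exists and is unique a.e. in `Ω` whenever all
truncations of `u` are in `W^{1,1}_loc(Ω)`; `0` if there is none). -/
def genGrad {N : ℕ} (Ω : Set (EuclideanSpace ℝ (Fin N)))
    (u : EuclideanSpace ℝ (Fin N) → ℝ) : EuclideanSpace ℝ (Fin N) → EuclideanSpace ℝ (Fin N) :=
  if hu : ∃ G, IsGenGradient Ω u G then hu.choose else 0

/-- `u` is an entropy solution of `-div a(x, u, ∇u) = h(u) f`, `u ≥ 0` in `Ω`, `u = 0` on `∂Ω`.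

Functions on `Ω` are total functions considered a.e. in `Ω`. The function `h` may take the value
`∞`; the summability of `h(u) f T_k(u - φ)` is expressed in `[0, ∞]` with `∞ * 0 = 0`, and it makes
this product a.e. finite, so that it is a.e. equal to the real product in `entropy_ineq`. -/
structure IsEntropySolution {N : ℕ} (Ω : Set (EuclideanSpace ℝ (Fin N))) (p : ℝ)
    (a : EuclideanSpace ℝ (Fin N) → ℝ → EuclideanSpace ℝ (Fin N) → EuclideanSpace ℝ (Fin N))
    (h : ℝ≥0 → ℝ≥0∞) (f u : EuclideanSpace ℝ (Fin N) → ℝ) : Prop where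
  meas : AEMeasurable u (volume.restrict Ω)
  nonneg : ∀ᵐ x ∂(volume.restrict Ω), 0 ≤ u x
  trunc_mem : ∀ k : ℝ, 0 < k → MemW01p Ω p (fun x => trunc k (u x))
  flux_mem : ∀ k : ℝ, 0 < k →
    MemLp (fun x => a x (trunc k (u x)) (weakGrad Ω (fun y => trunc k (u y)) x))
      (ENNReal.ofReal (p / (p - 1))) (volume.restrict Ω)
  source_mem : ∀ k : ℝ, 0 < k → ∀ φ : EuclideanSpace ℝ (Fin N) → ℝ,
    MemW01p Ω p φ → MemLp φ ∞ (volume.restrict Ω) →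
    ∫⁻ x in Ω, h (u x).toNNReal * ENNReal.ofReal |f x * trunc k (u x - φ x)| < ∞
  entropy_ineq : ∀ k : ℝ, 0 < k → ∀ φ : EuclideanSpace ℝ (Fin N) → ℝ,
    MemW01p Ω p φ → MemLp φ ∞ (volume.restrict Ω) →
    ∫ x in Ω, inner ℝ (a x (u x) (genGrad Ω u x))
        (weakGrad Ω (fun y => trunc k (u y - φ y)) x) ≤
      ∫ x in Ω, (h (u x).toNNReal).toReal * f x * trunc k (u x - φ x)

/-- The structure conditions on `A(x, ξ)`: it is a Carathéodory function, coercive, of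
`(p-1)`-growth and strictly monotone in `ξ`. -/
structure IsLerayLions {N : ℕ} (Ω : Set (EuclideanSpace ℝ (Fin N))) (p : ℝ)
    (A : EuclideanSpace ℝ (Fin N) → EuclideanSpace ℝ (Fin N) → EuclideanSpace ℝ (Fin N)) :
    Prop where
  meas : ∀ ξ, AEStronglyMeasurable (fun x => A x ξ) (volume.restrict Ω)
  cont : ∀ᵐ x ∂(volume.restrict Ω), Continuous (A x)
  coercive : ∀ᵐ x ∂(volume.restrict Ω), ∀ ξ, ‖ξ‖ ^ p ≤ inner ℝ (A x ξ) ξ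
  growth : ∃ β : ℝ, 0 < β ∧ ∃ l : EuclideanSpace ℝ (Fin N) → ℝ,
    (∀ᵐ x ∂(volume.restrict Ω), 0 ≤ l x) ∧
    MemLp l (ENNReal.ofReal (p / (p - 1))) (volume.restrict Ω) ∧
    ∀ᵐ x ∂(volume.restrict Ω), ∀ ξ, ‖A x ξ‖ ≤ β * (l x + ‖ξ‖ ^ (p - 1))
  strict_mono : ∀ᵐ x ∂(volume.restrict Ω), ∀ ξ ξ', ξ ≠ ξ' →
    0 < inner ℝ (A x ξ - A x ξ') (ξ - ξ')

end DegElliptic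

end

/-! ### Test functions, weak gradients and their stability under L¹ limits. -/

namespace DegElliptic

variable {N : ℕ} {Ω : Set (EuclideanSpace ℝ (Fin N))}

/-! Let u and v be entropy solutions. Test the inequality of u with `T_n(v)` and that of v with
`T_n(u)`, both with truncation height k, and add. Where u and v are at most n, the left-hand
integrands add up to b(u) (A(x,∇u) − A(x,∇v))·(∇u − ∇v), which is nonnegative, plus (b(u) − b(v))
A(x,∇v)·(∇u − ∇v). The second term lives on {0 < |u − v| < k}, where |b(u) − b(v)| ≤ Lk. After
division by k it is therefore bounded by L times the integral of a fixed integrable function over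
sets that shrink to ∅. On the right, (h(u) − h(v)) f T_k(u − v) is nonpositive, and divided by k it
equals −|h(u)f − h(v)f| wherever |u − v| ≥ k. If the contribution of values above n is negligible,
this forces h(u)f = h(v)f on {u ≠ v}. That set is then null, because h is strictly decreasing and f
> 0.

Above n, the right-hand side costs at most k times the integrals of h(u)f over {u > n} and of h(v)f
over {v > n}, which are tails of integrable functions. On the left, the only term without a sign is
the mixed one, such as b(u) A(x,∇u)·∇v where v ≤ n < u; there both values are within k of n. Young's
inequality bounds it by constants times b(u)(ℓ^{p'} + |∇u|^p + |∇v|^p), with p' = p/(p − 1), and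
Lipschitz continuity replaces b(u) by b(v) + Lk in front of |∇v|^p. The weighted energy of a
solution on a strip of width 2k is at most 2k times a tail of its source
(`IsEntropySolution.energy`). What is left is the integral of ℓ^{p'} over {n < u < n + k} and Lk
times the integral of |∇v|^p over {n − k < v ≤ n}.

The integral of ℓ^{p'} need not be O(k) at an individual level. Summed over levels of spacing k in
[n, n + 1], however, the strips are disjoint: the first integrals add up to at most a tail of ∫
ℓ^{p'}, and the gradient terms to at most Lk times the energy below n + 1. Letting k → 0 with n
fixed, and then n → ∞, removes everything.

The pointwise core consists of `crossFlux_add_crossFlux_ge` and `source_cross_le`; the averaging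
over levels is `IsEntropySolution.integral_sourceGap_le`. All three items of the theorem are
instances of `IsEntropySolution.ae_eq`. -/

theorem IsTestFunction.continuous_gradient {φ : EuclideanSpace ℝ (Fin N) → ℝ}
    (hφ : IsTestFunction Ω φ) : Continuous (gradient φ) :=
  (InnerProductSpace.toDual ℝ _).symm.continuous.comp
    (hφ.smooth.continuous_fderiv (by simp))

theorem gradient_eq_zero_of_notMem_tsupport {φ : EuclideanSpace ℝ (Fin N) → ℝ}
    {x : EuclideanSpace ℝ (Fin N)} (hx : x ∉ tsupport φ) : gradient φ x = 0 := by
  have : fderiv ℝ φ x = 0 := by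
    by_contra hne
    exact hx (support_fderiv_subset ℝ (Function.mem_support.2 hne))
  simp [gradient, this]

theorem IsTestFunction.hasCompactSupport_gradient {φ : EuclideanSpace ℝ (Fin N) → ℝ}
    (hφ : IsTestFunction Ω φ) : HasCompactSupport (gradient φ) :=
  HasCompactSupport.intro hφ.compact_support fun _ hx => gradient_eq_zero_of_notMem_tsupport hx

theorem IsTestFunction.exists_gradient_bound {φ : EuclideanSpace ℝ (Fin N) → ℝ}
    (hφ : IsTestFunction Ω φ) : ∃ C, ∀ x, ‖gradient φ x‖ ≤ C :=
  hφ.hasCompactSupport_gradient.exists_bound_of_continuous hφ.continuous_gradient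

theorem IsTestFunction.exists_bound {φ : EuclideanSpace ℝ (Fin N) → ℝ}
    (hφ : IsTestFunction Ω φ) : ∃ C, ∀ x, ‖φ x‖ ≤ C :=
  hφ.compact_support.exists_bound_of_continuous hφ.smooth.continuous

theorem IsTestFunction.sub {φ ψ : EuclideanSpace ℝ (Fin N) → ℝ}
    (hφ : IsTestFunction Ω φ) (hψ : IsTestFunction Ω ψ) :
    IsTestFunction Ω (fun x => φ x - ψ x) where
  smooth := hφ.smooth.sub hψ.smooth
  compact_support := hφ.compact_support.sub hψ.compact_support
  support_subset := (tsupport_sub φ ψ).trans (union_subset hφ.support_subset hψ.support_subset)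

theorem IsTestFunction.gradient_sub {φ ψ : EuclideanSpace ℝ (Fin N) → ℝ}
    (hφ : IsTestFunction Ω φ) (hψ : IsTestFunction Ω ψ) (x : EuclideanSpace ℝ (Fin N)) :
    gradient (fun x => φ x - ψ x) x = gradient φ x - gradient ψ x := by
  have h1 : DifferentiableAt ℝ φ x := hφ.smooth.differentiable (by simp) x
  have h2 : DifferentiableAt ℝ ψ x := hψ.smooth.differentiable (by simp) x
  have : fderiv ℝ (fun x => φ x - ψ x) x = fderiv ℝ φ x - fderiv ℝ ψ x := fderiv_sub h1 h2
  simp [gradient, this]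

/-- Integration by parts for a `C¹` function of a test function. -/
theorem IsTestFunction.integral_comp_smul_gradient {φ ψ : EuclideanSpace ℝ (Fin N) → ℝ}
    (hφ : IsTestFunction Ω φ) (hψ : IsTestFunction Ω ψ) {S S' : ℝ → ℝ}
    (hS : ∀ s, HasDerivAt S (S' s) s) (hS' : Continuous S') :
    ∫ x in Ω, S (φ x) • gradient ψ x = - ∫ x in Ω, ψ x • (S' (φ x) • gradient φ x) := by
  have hSc : Continuous S := continuous_iff_continuousAt.2 fun s => (hS s).continuousAt
  have cφ := hφ.smooth.continuous
  have cψ := hψ.smooth.continuous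
  have cgφ := hφ.continuous_gradient
  have cgψ := hψ.continuous_gradient
  rw [setIntegral_eq_integral_of_forall_compl_eq_zero,
    setIntegral_eq_integral_of_forall_compl_eq_zero]
  rotate_left
  · intro x hx
    have : ψ x = 0 := image_eq_zero_of_notMem_tsupport fun h => hx (hψ.support_subset h)
    simp [this]
  · intro x hx
    rw [gradient_eq_zero_of_notMem_tsupport fun h => hx (hψ.support_subset h), smul_zero]
  have i1 : Integrable (fun x => S (φ x) • gradient ψ x) :=
    ((hSc.comp cφ).smul cgψ).integrable_of_hasCompactSupport
      (hψ.hasCompactSupport_gradient.smul_left (f := fun x => S (φ x)))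
  have i2 : Integrable (fun x => ψ x • (S' (φ x) • gradient φ x)) :=
    (cψ.smul ((hS'.comp cφ).smul cgφ)).integrable_of_hasCompactSupport
      (hψ.compact_support.smul_right)
  -- Pairing with a fixed vector e reduces the vector identity to scalar integration by parts in the
  -- direction e.
  refine ext_inner_left ℝ fun e => ?_
  rw [inner_neg_right, ← integral_inner i1, ← integral_inner i2]
  have hd : ∀ x, HasFDerivAt (fun x => S (φ x)) (S' (φ x) • fderiv ℝ φ x) x := fun x =>
    (hS (φ x)).comp_hasFDerivAt x (hφ.smooth.differentiable (by simp) x).hasFDerivAt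
  have key := integral_mul_fderiv_eq_neg_fderiv_mul_of_integrable (μ := volume)
    (f := fun x => S (φ x)) (g := ψ) (v := e) ?_ ?_ ?_ (fun x _ => (hd x).differentiableAt)
    (fun x _ => hψ.smooth.differentiable (by simp) x)
  · have e1 : ∀ x, inner ℝ e (S (φ x) • gradient ψ x) = S (φ x) * fderiv ℝ ψ x e := fun x => by
      rw [inner_smul_right, real_inner_comm, inner_gradient_left]
    have e2 : ∀ x, inner ℝ e (ψ x • (S' (φ x) • gradient φ x)) =
        fderiv ℝ (fun x => S (φ x)) x e * ψ x := fun x => by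
      rw [inner_smul_right, inner_smul_right, real_inner_comm, inner_gradient_left, (hd x).fderiv]
      simp [mul_comm]
    simp_rw [e1, e2]
    exact key
  · refine (i2.const_inner e).congr (Eventually.of_forall fun x => ?_)
    simp only
    rw [inner_smul_right, inner_smul_right, real_inner_comm, inner_gradient_left, (hd x).fderiv]
    simp [mul_comm]
  · refine (i1.const_inner e).congr (Eventually.of_forall fun x => ?_)
    simp only
    rw [inner_smul_right, real_inner_comm, inner_gradient_left]
  · exact ((hSc.comp cφ).mul cψ).integrable_of_hasCompactSupport
      hψ.compact_support.mul_left

theorem IsWeakGradient.congr {v v' : EuclideanSpace ℝ (Fin N) → ℝ}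
    {g g' : EuclideanSpace ℝ (Fin N) → EuclideanSpace ℝ (Fin N)} (hg : IsWeakGradient Ω v g)
    (hv : v =ᵐ[volume.restrict Ω] v')
    (hgg : g =ᵐ[volume.restrict Ω] g') : IsWeakGradient Ω v' g' where
  locInt := fun x hx => by
    obtain ⟨s, hs, hi⟩ := hg.locInt x hx
    refine ⟨s ∩ Ω, inter_mem hs self_mem_nhdsWithin, ?_⟩
    exact (hi.mono_set inter_subset_left).congr_fun_ae
      (ae_mono (Measure.restrict_mono inter_subset_right le_rfl) hv)
  locInt_grad := fun x hx => by
    obtain ⟨s, hs, hi⟩ := hg.locInt_grad x hx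
    refine ⟨s ∩ Ω, inter_mem hs self_mem_nhdsWithin, ?_⟩
    exact (hi.mono_set inter_subset_left).congr_fun_ae
      (ae_mono (Measure.restrict_mono inter_subset_right le_rfl) hgg)
  integral_eq := fun φ hφ => by
    have h1 : ∫ x in Ω, v' x • gradient φ x = ∫ x in Ω, v x • gradient φ x :=
      integral_congr_ae (by filter_upwards [hv] with x hx; rw [hx])
    have h2 : ∫ x in Ω, φ x • g' x = ∫ x in Ω, φ x • g x :=
      integral_congr_ae (by filter_upwards [hgg] with x hx; rw [hx])
    rw [h1, h2, hg.integral_eq φ hφ]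

theorem LocallyIntegrableOn.integrable_test_smul
    {g : EuclideanSpace ℝ (Fin N) → EuclideanSpace ℝ (Fin N)}
    (hg : LocallyIntegrableOn g Ω volume) {φ : EuclideanSpace ℝ (Fin N) → ℝ}
    (hφ : IsTestFunction Ω φ) : IntegrableOn (fun x => φ x • g x) Ω := by
  have hK := hg.integrableOn_compact_subset hφ.support_subset hφ.compact_support
  obtain ⟨C, hC⟩ := hφ.exists_bound
  have h1 : IntegrableOn (fun x => φ x • g x) (tsupport φ) :=
    hK.bdd_smul (C := C) hφ.smooth.continuous.aestronglyMeasurable (Eventually.of_forall hC)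
  refine (integrableOn_iff_integrable_of_support_subset ?_).1 h1 |>.integrableOn
  intro x hx
  by_contra hx'
  exact hx (by simp [image_eq_zero_of_notMem_tsupport hx'])

/-- Weak gradients are unique almost everywhere. -/
theorem IsWeakGradient.ae_eq {v : EuclideanSpace ℝ (Fin N) → ℝ}
    {g g' : EuclideanSpace ℝ (Fin N) → EuclideanSpace ℝ (Fin N)} (hΩ : IsOpen Ω)
    (hg : IsWeakGradient Ω v g) (hg' : IsWeakGradient Ω v g') :
    g =ᵐ[volume.restrict Ω] g' := by
  have key : ∀ᵐ x ∂volume, x ∈ Ω → (g - g') x = 0 := by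
    refine hΩ.ae_eq_zero_of_integral_contDiff_smul_eq_zero
      (hg.locInt_grad.sub hg'.locInt_grad) fun φ h1 h2 h3 => ?_
    have hφ : IsTestFunction Ω φ := ⟨h1, h2, h3⟩
    have e1 := hg.integral_eq φ hφ
    rw [hg'.integral_eq φ hφ, neg_inj] at e1
    rw [← setIntegral_eq_integral_of_forall_compl_eq_zero (s := Ω)]
    · simp only [Pi.sub_apply, smul_sub]
      rw [integral_sub (LocallyIntegrableOn.integrable_test_smul hg.locInt_grad hφ)
        (LocallyIntegrableOn.integrable_test_smul hg'.locInt_grad hφ), e1, sub_self]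
    · intro x hx
      have : φ x = 0 := image_eq_zero_of_notMem_tsupport fun h => hx (h3 h)
      simp [this]
  have := (ae_restrict_iff' hΩ.measurableSet).2 key
  filter_upwards [this] with x hx
  exact sub_eq_zero.1 hx

theorem IsWeakGradient.weakGrad_ae_eq {v : EuclideanSpace ℝ (Fin N) → ℝ}
    {g : EuclideanSpace ℝ (Fin N) → EuclideanSpace ℝ (Fin N)} (hΩ : IsOpen Ω)
    (hg : IsWeakGradient Ω v g) : weakGrad Ω v =ᵐ[volume.restrict Ω] g := by
  have hex : ∃ g, IsWeakGradient Ω v g := ⟨g, hg⟩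
  have : weakGrad Ω v = hex.choose := by simp [weakGrad, hex]
  rw [this]
  exact hex.choose_spec.ae_eq hΩ hg

/-- Weak gradients pass to the limit in `L¹(Ω)`. -/
theorem IsWeakGradient.of_tendsto {v : EuclideanSpace ℝ (Fin N) → ℝ}
    {g : EuclideanSpace ℝ (Fin N) → EuclideanSpace ℝ (Fin N)}
    {vn : ℕ → EuclideanSpace ℝ (Fin N) → ℝ}
    {gn : ℕ → EuclideanSpace ℝ (Fin N) → EuclideanSpace ℝ (Fin N)}
    (hv : IntegrableOn v Ω) (hg : IntegrableOn g Ω)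
    (hvn : ∀ n, IntegrableOn (vn n) Ω) (hgn : ∀ n, IntegrableOn (gn n) Ω)
    (hvg : ∀ n, ∀ φ : EuclideanSpace ℝ (Fin N) → ℝ, IsTestFunction Ω φ →
      ∫ x in Ω, vn n x • gradient φ x = - ∫ x in Ω, φ x • gn n x)
    (hlv : Tendsto (fun n => ∫⁻ x in Ω, ‖vn n x - v x‖ₑ) atTop (𝓝 0))
    (hlg : Tendsto (fun n => ∫⁻ x in Ω, ‖gn n x - g x‖ₑ) atTop (𝓝 0)) :
    IsWeakGradient Ω v g where
  locInt := hv.locallyIntegrableOn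
  locInt_grad := hg.locallyIntegrableOn
  integral_eq := fun φ hφ => by
    obtain ⟨C, hC⟩ := hφ.exists_bound
    obtain ⟨D, hD⟩ := hφ.exists_gradient_bound
    have mφ : AEStronglyMeasurable φ (volume.restrict Ω) :=
      hφ.smooth.continuous.aestronglyMeasurable
    have mg : AEStronglyMeasurable (gradient φ) (volume.restrict Ω) :=
      hφ.continuous_gradient.aestronglyMeasurable
    have iv : ∀ w : EuclideanSpace ℝ (Fin N) → ℝ, IntegrableOn w Ω →
        IntegrableOn (fun x => w x • gradient φ x) Ω := fun w hw =>
      Integrable.smul_bdd (C := D) hw mg (Eventually.of_forall hD)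
    have ig : ∀ w : EuclideanSpace ℝ (Fin N) → EuclideanSpace ℝ (Fin N), IntegrableOn w Ω →
        IntegrableOn (fun x => φ x • w x) Ω := fun w hw =>
      Integrable.bdd_smul (C := C) hw mφ (Eventually.of_forall hC)
    have t1 : Tendsto (fun n => ∫ x in Ω, vn n x • gradient φ x) atTop
        (𝓝 (∫ x in Ω, v x • gradient φ x)) := by
      refine tendsto_integral_of_L1 _ (iv v hv).aestronglyMeasurable
        (Eventually.of_forall fun n => iv _ (hvn n)) ?_
      refine tendsto_of_tendsto_of_tendsto_of_le_of_le tendsto_const_nhds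
        (h := fun n => (∫⁻ x in Ω, ‖vn n x - v x‖ₑ) * ENNReal.ofReal D) ?_
        (fun _ => zero_le) fun n => ?_
      · simpa using ENNReal.Tendsto.mul_const hlv (Or.inr ENNReal.ofReal_ne_top)
      · beta_reduce
        rw [← lintegral_mul_const' _ _ ENNReal.ofReal_ne_top]
        refine lintegral_mono fun x => ?_
        rw [← sub_smul, enorm_smul]
        gcongr
        rw [← ofReal_norm]
        exact ENNReal.ofReal_le_ofReal (hD x)
    have t2 : Tendsto (fun n => ∫ x in Ω, φ x • gn n x) atTop
        (𝓝 (∫ x in Ω, φ x • g x)) := by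
      refine tendsto_integral_of_L1 _ (ig g hg).aestronglyMeasurable
        (Eventually.of_forall fun n => ig _ (hgn n)) ?_
      refine tendsto_of_tendsto_of_tendsto_of_le_of_le tendsto_const_nhds
        (h := fun n => ENNReal.ofReal C * (∫⁻ x in Ω, ‖gn n x - g x‖ₑ)) ?_
        (fun _ => zero_le) fun n => ?_
      · simpa using ENNReal.Tendsto.const_mul hlg (Or.inr ENNReal.ofReal_ne_top)
      · beta_reduce
        rw [← lintegral_const_mul' _ _ ENNReal.ofReal_ne_top]
        refine lintegral_mono fun x => ?_
        rw [← smul_sub, enorm_smul]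
        gcongr
        rw [← ofReal_norm]
        exact ENNReal.ofReal_le_ofReal (hC x)
    refine tendsto_nhds_unique t1 ?_
    simp_rw [hvg _ φ hφ]
    exact t2.neg

/-- `v` and `g` are the limits in `L¹(Ω)` of test functions and of their gradients. -/
structure IsTestLimit (Ω : Set (EuclideanSpace ℝ (Fin N))) (v : EuclideanSpace ℝ (Fin N) → ℝ)
    (g : EuclideanSpace ℝ (Fin N) → EuclideanSpace ℝ (Fin N)) : Prop where
  int : IntegrableOn v Ω
  int_grad : IntegrableOn g Ω
  approx : ∃ φ : ℕ → EuclideanSpace ℝ (Fin N) → ℝ, (∀ n, IsTestFunction Ω (φ n)) ∧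
    Tendsto (fun n => ∫⁻ x in Ω, ‖φ n x - v x‖ₑ) atTop (𝓝 0) ∧
    Tendsto (fun n => ∫⁻ x in Ω, ‖gradient (φ n) x - g x‖ₑ) atTop (𝓝 0)

theorem IsTestLimit.sub {v v' : EuclideanSpace ℝ (Fin N) → ℝ}
    {g g' : EuclideanSpace ℝ (Fin N) → EuclideanSpace ℝ (Fin N)}
    (h : IsTestLimit Ω v g) (h' : IsTestLimit Ω v' g') :
    IsTestLimit Ω (fun x => v x - v' x) (fun x => g x - g' x) where
  int := h.int.sub h'.int
  int_grad := h.int_grad.sub h'.int_grad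
  approx := by
    obtain ⟨φ, hφ, t1, t2⟩ := h.approx
    obtain ⟨ψ, hψ, t1', t2'⟩ := h'.approx
    refine ⟨fun n x => φ n x - ψ n x, fun n => (hφ n).sub (hψ n), ?_, ?_⟩
    · have t := t1.add t1'
      rw [add_zero] at t
      refine tendsto_of_tendsto_of_tendsto_of_le_of_le tendsto_const_nhds t
        (fun _ => zero_le) fun n => ?_
      have hm : AEMeasurable (fun x => ‖φ n x - v x‖ₑ) (volume.restrict Ω) :=
        ((hφ n).smooth.continuous.aestronglyMeasurable.sub h.int.aestronglyMeasurable).enorm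
      rw [← lintegral_add_left' hm]
      refine lintegral_mono fun x => ?_
      rw [show φ n x - ψ n x - (v x - v' x) = (φ n x - v x) - (ψ n x - v' x) by ring]
      exact enorm_sub_le
    · have t := t2.add t2'
      rw [add_zero] at t
      refine tendsto_of_tendsto_of_tendsto_of_le_of_le tendsto_const_nhds t
        (fun _ => zero_le) fun n => ?_
      have hm : AEMeasurable (fun x => ‖gradient (φ n) x - g x‖ₑ) (volume.restrict Ω) :=
        ((hφ n).continuous_gradient.aestronglyMeasurable.sub
          h.int_grad.aestronglyMeasurable).enorm
      rw [← lintegral_add_left' hm]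
      refine lintegral_mono fun x => ?_
      rw [(hφ n).gradient_sub (hψ n), show gradient (φ n) x - gradient (ψ n) x - (g x - g' x) =
        (gradient (φ n) x - g x) - (gradient (ψ n) x - g' x) by abel]
      exact enorm_sub_le

/-- On a set of finite measure, convergence in L^p implies convergence in L¹, and the chain rules
need only the latter. -/
theorem MemW01p.exists_isTestLimit {p : ℝ} (hp : 1 ≤ p) (hΩ : volume Ω ≠ ∞)
    {v : EuclideanSpace ℝ (Fin N) → ℝ} (hv : MemW01p Ω p v) :
    ∃ g, IsWeakGradient Ω v g ∧ MemLp g (ENNReal.ofReal p) (volume.restrict Ω) ∧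
      IsTestLimit Ω v g := by
  obtain ⟨hvp, g, hg, hgp, φ, hφ, t1, t2⟩ := hv
  have : IsFiniteMeasure (volume.restrict Ω) := ⟨by simpa using hΩ.lt_top⟩
  have hp' : 1 ≤ ENNReal.ofReal p := by simpa using hp
  refine ⟨g, hg, hgp, hvp.integrable hp', hgp.integrable hp', φ, hφ, ?_, ?_⟩
  · have t := ENNReal.Tendsto.mul_const t1 (b := (volume.restrict Ω) univ ^
      (1 / (1 : ℝ≥0∞).toReal - 1 / (ENNReal.ofReal p).toReal)) (Or.inr (by
        refine ENNReal.rpow_ne_top_of_nonneg ?_ (measure_ne_top _ _)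
        rw [ENNReal.toReal_ofReal (by linarith)]
        have : 1 / p ≤ 1 := by rw [div_le_one (by linarith)]; exact hp
        simpa using this))
    rw [zero_mul] at t
    refine tendsto_of_tendsto_of_tendsto_of_le_of_le tendsto_const_nhds t
        (fun _ => zero_le) fun n => ?_
    simp only [← eLpNorm_one_eq_lintegral_enorm]
    exact eLpNorm_le_eLpNorm_mul_rpow_measure_univ hp'
      ((hφ n).smooth.continuous.aestronglyMeasurable.sub hvp.aestronglyMeasurable)
  · have t := ENNReal.Tendsto.mul_const t2 (b := (volume.restrict Ω) univ ^
      (1 / (1 : ℝ≥0∞).toReal - 1 / (ENNReal.ofReal p).toReal)) (Or.inr (by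
        refine ENNReal.rpow_ne_top_of_nonneg ?_ (measure_ne_top _ _)
        rw [ENNReal.toReal_ofReal (by linarith)]
        have : 1 / p ≤ 1 := by rw [div_le_one (by linarith)]; exact hp
        simpa using this))
    rw [zero_mul] at t
    refine tendsto_of_tendsto_of_tendsto_of_le_of_le tendsto_const_nhds t
        (fun _ => zero_le) fun n => ?_
    simp only [← eLpNorm_one_eq_lintegral_enorm]
    exact eLpNorm_le_eLpNorm_mul_rpow_measure_univ hp'
      ((hφ n).continuous_gradient.aestronglyMeasurable.sub hgp.aestronglyMeasurable)

end DegElliptic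

/-! ### Chain rule, gradients on level sets, gradients of truncations. -/

namespace DegElliptic

variable {N : ℕ} {Ω : Set (EuclideanSpace ℝ (Fin N))}

theorem lipschitzWith_of_hasDerivAt_of_abs_le {S S' : ℝ → ℝ} {K : ℝ≥0}
    (hS : ∀ s, HasDerivAt S (S' s) s) (hK : ∀ s, |S' s| ≤ K) : LipschitzWith K S :=
  lipschitzWith_of_nnnorm_deriv_le (fun s => (hS s).differentiableAt) fun s => by
    rw [(hS s).deriv, ← NNReal.coe_le_coe]
    exact hK s

/-- The chain rule for weak gradients. -/
theorem IsTestLimit.comp {v : EuclideanSpace ℝ (Fin N) → ℝ}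
    {g : EuclideanSpace ℝ (Fin N) → EuclideanSpace ℝ (Fin N)} (hv : IsTestLimit Ω v g)
    (hΩ : volume Ω ≠ ∞) {S S' : ℝ → ℝ} {K : ℝ≥0}
    (hS : ∀ s, HasDerivAt S (S' s) s) (hS' : Continuous S') (hK : ∀ s, |S' s| ≤ K) :
    IsWeakGradient Ω (fun x => S (v x)) (fun x => S' (v x) • g x) := by
  have hfin : IsFiniteMeasure (volume.restrict Ω) := ⟨by simpa using hΩ.lt_top⟩
  have hSc : Continuous S := continuous_iff_continuousAt.2 fun s => (hS s).continuousAt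
  have hL := lipschitzWith_of_hasDerivAt_of_abs_le hS hK
  have hi : ∀ w : EuclideanSpace ℝ (Fin N) → ℝ, IntegrableOn w Ω →
      IntegrableOn (fun x => S (w x)) Ω := fun w hw => by
    have : Integrable (fun x => |S 0| + K * |w x|) (volume.restrict Ω) :=
      (integrable_const _).add (hw.abs.const_mul _)
    refine this.mono' (hSc.comp_aestronglyMeasurable hw.aestronglyMeasurable)
      (Eventually.of_forall fun x => ?_)
    have h1 := hL.dist_le_mul (w x) 0
    rw [Real.dist_eq, Real.dist_eq, sub_zero] at h1
    rw [Real.norm_eq_abs]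
    linarith [abs_sub_abs_le_abs_sub (S (w x)) (S 0)]
  have hig : ∀ (w : EuclideanSpace ℝ (Fin N) → ℝ)
      (G : EuclideanSpace ℝ (Fin N) → EuclideanSpace ℝ (Fin N)),
      AEStronglyMeasurable w (volume.restrict Ω) →
      IntegrableOn G Ω → IntegrableOn (fun x => S' (w x) • G x) Ω := fun w G hw hG =>
    Integrable.bdd_smul (C := K) hG (hS'.comp_aestronglyMeasurable hw)
      (Eventually.of_forall fun x => hK _)
  obtain ⟨φ, hφ, t1, t2⟩ := hv.approx
  have mv := hv.int.aestronglyMeasurable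
  have mφ : ∀ n, AEStronglyMeasurable (φ n) (volume.restrict Ω) := fun n =>
    (hφ n).smooth.continuous.aestronglyMeasurable
  have hmeas : TendstoInMeasure (volume.restrict Ω) φ atTop v := by
    refine tendstoInMeasure_of_tendsto_eLpNorm one_ne_zero mφ mv ?_
    simp only [eLpNorm_one_eq_lintegral_enorm]
    exact t1
  -- As S' is merely continuous, `S' (φ n) • g` is handled by dominated convergence, which needs
  -- pointwise convergence and hence a subsequence.
  obtain ⟨ns, hns, hae⟩ := hmeas.exists_seq_tendsto_ae
  have t1' := t1.comp hns.tendsto_atTop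
  have t2' := t2.comp hns.tendsto_atTop
  have iφ : ∀ n, IntegrableOn (φ n) Ω := fun n =>
    ((hφ n).smooth.continuous.integrable_of_hasCompactSupport (hφ n).compact_support).integrableOn
  have igφ : ∀ n, IntegrableOn (gradient (φ n)) Ω := fun n =>
    ((hφ n).continuous_gradient.integrable_of_hasCompactSupport
      (hφ n).hasCompactSupport_gradient).integrableOn
  refine IsWeakGradient.of_tendsto (vn := fun n x => S (φ (ns n) x))
    (gn := fun n x => S' (φ (ns n) x) • gradient (φ (ns n)) x) (hi v hv.int)
    (hig v g mv hv.int_grad) (fun n => hi _ (iφ _)) (fun n => hig _ _ (mφ _) (igφ _))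
    (fun n ψ hψ => (hφ (ns n)).integral_comp_smul_gradient hψ hS hS') ?_ ?_
  · have t := ENNReal.Tendsto.const_mul t1' (a := (K : ℝ≥0∞)) (Or.inr ENNReal.coe_ne_top)
    rw [mul_zero] at t
    refine tendsto_of_tendsto_of_tendsto_of_le_of_le tendsto_const_nhds t
      (fun _ => zero_le) fun n => ?_
    simp only [Function.comp]
    rw [← lintegral_const_mul' _ _ ENNReal.coe_ne_top]
    refine lintegral_mono fun x => ?_
    rw [← edist_eq_enorm_sub, ← edist_eq_enorm_sub]
    exact hL.edist_le_mul _ _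
  · have t3 := tendsto_lintegral_norm_of_dominated_convergence
      (F := fun n x => S' (φ (ns n) x) • g x) (f := fun x => S' (v x) • g x)
      (μ := volume.restrict Ω) (bound := fun x => K * ‖g x‖)
      (fun n => (hig _ _ (mφ _) hv.int_grad).aestronglyMeasurable)
      (hv.int_grad.norm.const_mul _).hasFiniteIntegral
      (fun n => Eventually.of_forall fun x => by
        rw [norm_smul]
        gcongr
        exact hK _)
      (by
        filter_upwards [hae] with x hx
        exact ((hS'.tendsto _).comp hx).smul_const _)
    have t := (ENNReal.Tendsto.const_mul t2' (a := (K : ℝ≥0∞))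
      (Or.inr ENNReal.coe_ne_top)).add t3
    rw [mul_zero, add_zero] at t
    refine tendsto_of_tendsto_of_tendsto_of_le_of_le tendsto_const_nhds t
      (fun _ => zero_le) fun n => ?_
    simp only [Function.comp]
    have hm : AEMeasurable (fun x => (K : ℝ≥0∞) * ‖gradient (φ (ns n)) x - g x‖ₑ)
        (volume.restrict Ω) :=
      ((igφ (ns n)).aestronglyMeasurable.sub hv.int_grad.aestronglyMeasurable).enorm.const_mul _
    rw [← lintegral_const_mul' _ _ ENNReal.coe_ne_top, ← lintegral_add_left' hm]
    refine lintegral_mono fun x => ?_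
    -- The first summand is small because the gradients converge and S' is bounded, the second by
    -- `t3`.
    have e : S' (φ (ns n) x) • gradient (φ (ns n)) x - S' (v x) • g x =
        S' (φ (ns n) x) • (gradient (φ (ns n)) x - g x) +
          (S' (φ (ns n) x) • g x - S' (v x) • g x) := by
      rw [smul_sub]; abel
    rw [e]
    refine (enorm_add_le _ _).trans ?_
    rw [ofReal_norm, enorm_smul]
    gcongr
    rw [← ofReal_norm, ← ENNReal.ofReal_coe_nnreal]
    exact ENNReal.ofReal_le_ofReal (hK _)

/-- The chain rule for pointwise limits of `C¹` functions with bounded derivatives. -/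
theorem IsTestLimit.comp_of_tendsto {v : EuclideanSpace ℝ (Fin N) → ℝ}
    {g : EuclideanSpace ℝ (Fin N) → EuclideanSpace ℝ (Fin N)} (hv : IsTestLimit Ω v g)
    (hΩ : volume Ω ≠ ∞) {S S' : ℕ → ℝ → ℝ} {T τ : ℝ → ℝ} {K : ℝ≥0} {D : ℝ}
    (hS : ∀ n s, HasDerivAt (S n) (S' n s) s) (hS' : ∀ n, Continuous (S' n))
    (hK : ∀ n s, |S' n s| ≤ K) (hD : ∀ n, |S n 0| ≤ D)
    (hT : ∀ s, Tendsto (fun n => S n s) atTop (𝓝 (T s)))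
    (hτ : ∀ s, Tendsto (fun n => S' n s) atTop (𝓝 (τ s))) :
    IsWeakGradient Ω (fun x => T (v x)) (fun x => τ (v x) • g x) := by
  have hfin : IsFiniteMeasure (volume.restrict Ω) := ⟨by simpa using hΩ.lt_top⟩
  have hSc : ∀ n, Continuous (S n) := fun n =>
    continuous_iff_continuousAt.2 fun s => (hS n s).continuousAt
  have mv := hv.int.aestronglyMeasurable
  have mS : ∀ n, AEStronglyMeasurable (fun x => S n (v x)) (volume.restrict Ω) := fun n =>
    (hSc n).comp_aestronglyMeasurable mv
  have mS' : ∀ n, AEStronglyMeasurable (fun x => S' n (v x) • g x) (volume.restrict Ω) := fun n =>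
    ((hS' n).comp_aestronglyMeasurable mv).smul hv.int_grad.aestronglyMeasurable
  have lS : ∀ x, Tendsto (fun n => S n (v x)) atTop (𝓝 (T (v x))) := fun x => hT _
  have lS' : ∀ x, Tendsto (fun n => S' n (v x) • g x) atTop (𝓝 (τ (v x) • g x)) := fun x =>
    (hτ _).smul_const _
  have bS : ∀ n x, ‖S n (v x)‖ ≤ D + K * |v x| := fun n x => by
    have h1 := (lipschitzWith_of_hasDerivAt_of_abs_le (hS n) (hK n)).dist_le_mul (v x) 0
    rw [Real.dist_eq, Real.dist_eq, sub_zero] at h1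
    rw [Real.norm_eq_abs]
    linarith [abs_sub_abs_le_abs_sub (S n (v x)) (S n 0), hD n]
  have bS' : ∀ n x, ‖S' n (v x) • g x‖ ≤ K * ‖g x‖ := fun n x => by
    rw [norm_smul]
    gcongr
    exact hK _ _
  have ib : Integrable (fun x => D + K * |v x|) (volume.restrict Ω) :=
    (integrable_const _).add (hv.int.abs.const_mul _)
  have ib' : Integrable (fun x => K * ‖g x‖) (volume.restrict Ω) := hv.int_grad.norm.const_mul _
  refine IsWeakGradient.of_tendsto (vn := fun n x => S n (v x)) (gn := fun n x => S' n (v x) • g x)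
    ?_ ?_ ?_ ?_ (fun n ψ hψ => (hv.comp hΩ (hS n) (hS' n) (hK n)).integral_eq ψ hψ) ?_ ?_
  · exact ib.mono' (aestronglyMeasurable_of_tendsto_ae atTop mS (Eventually.of_forall lS))
      (Eventually.of_forall fun x => le_of_tendsto (lS x).norm (Eventually.of_forall fun n => bS n x))
  · exact ib'.mono' (aestronglyMeasurable_of_tendsto_ae atTop mS' (Eventually.of_forall lS'))
      (Eventually.of_forall fun x =>
        le_of_tendsto (lS' x).norm (Eventually.of_forall fun n => bS' n x))
  · exact fun n => ib.mono' (mS n) (Eventually.of_forall (bS n))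
  · exact fun n => ib'.mono' (mS' n) (Eventually.of_forall (bS' n))
  · simp only [← ofReal_norm]
    exact tendsto_lintegral_norm_of_dominated_convergence mS ib.hasFiniteIntegral
      (fun n => Eventually.of_forall (bS n)) (Eventually.of_forall lS)
  · simp only [← ofReal_norm]
    exact tendsto_lintegral_norm_of_dominated_convergence mS' ib'.hasFiniteIntegral
      (fun n => Eventually.of_forall (bS' n)) (Eventually.of_forall lS')

theorem isWeakGradient_zero : IsWeakGradient Ω (fun _ => 0) (fun _ => 0) where
  locInt := locallyIntegrableOn_zero
  locInt_grad := locallyIntegrableOn_zero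
  integral_eq := fun φ _ => by simp

theorem tendsto_inv_nat_succ : Tendsto (fun n : ℕ => 1 / ((n : ℝ) + 1)) atTop (𝓝 0) :=
  tendsto_one_div_add_atTop_nhds_zero_nat

/-- The weak gradient vanishes on level sets. -/
theorem IsTestLimit.grad_eq_zero_of_level {v : EuclideanSpace ℝ (Fin N) → ℝ}
    {g : EuclideanSpace ℝ (Fin N) → EuclideanSpace ℝ (Fin N)} (hv : IsTestLimit Ω v g)
    (hΩo : IsOpen Ω) (hΩ : volume Ω ≠ ∞) (c : ℝ) :
    ∀ᵐ x ∂(volume.restrict Ω), v x = c → g x = 0 := by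
  -- These functions tend to 0 while their derivatives tend to the indicator of {c}. The chain rule
  -- then makes χ_{v = c} g a weak gradient of the zero function.
  have key := hv.comp_of_tendsto hΩ (K := 1) (D := Real.pi / 2)
    (S := fun n s => 1 / ((n : ℝ) + 1) * Real.arctan (((n : ℝ) + 1) * (s - c)))
    (S' := fun n s => 1 / (1 + (((n : ℝ) + 1) * (s - c)) ^ 2))
    (T := fun _ => 0) (τ := fun s => if s = c then 1 else 0) ?_ ?_ ?_ ?_ ?_ ?_
  · filter_upwards [key.ae_eq hΩo isWeakGradient_zero] with x hx hxc
    simpa [hxc] using hx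
  · intro n s
    have hn : (0 : ℝ) < n + 1 := by positivity
    have h1 : HasDerivAt (fun s : ℝ => ((n : ℝ) + 1) * (s - c)) ((n : ℝ) + 1) s := by
      simpa using ((hasDerivAt_id s).sub_const c).const_mul ((n : ℝ) + 1)
    refine ((h1.arctan).const_mul (1 / ((n : ℝ) + 1))).congr_deriv ?_
    field_simp
  · intro n
    refine continuous_const.div (by fun_prop) fun s => by positivity
  · intro n s
    rw [abs_of_nonneg (by positivity), NNReal.coe_one, div_le_one (by positivity)]
    nlinarith [sq_nonneg (((n : ℝ) + 1) * (s - c))]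
  · intro n
    have hn : (0 : ℝ) < n + 1 := by positivity
    rw [abs_mul, abs_of_nonneg (by positivity : 0 ≤ 1 / ((n : ℝ) + 1))]
    have h1 : 1 / ((n : ℝ) + 1) ≤ 1 := by rw [div_le_one hn]; linarith [Nat.cast_nonneg (α := ℝ) n]
    have h2 : |Real.arctan (((n : ℝ) + 1) * (0 - c))| ≤ Real.pi / 2 :=
      abs_le.2 ⟨(Real.neg_pi_div_two_lt_arctan _).le, (Real.arctan_lt_pi_div_two _).le⟩
    calc _ ≤ 1 * (Real.pi / 2) := by gcongr
      _ = _ := one_mul _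
  · intro s
    refine squeeze_zero_norm (a := fun n : ℕ => 1 / ((n : ℝ) + 1) * (Real.pi / 2)) (fun n => ?_) ?_
    · rw [norm_mul, Real.norm_of_nonneg (by positivity : 0 ≤ 1 / ((n : ℝ) + 1))]
      gcongr
      exact abs_le.2 ⟨(Real.neg_pi_div_two_lt_arctan _).le, (Real.arctan_lt_pi_div_two _).le⟩
    · simpa using tendsto_inv_nat_succ.mul_const (Real.pi / 2)
  · intro s
    by_cases hs : s = c
    · simp [hs]
    · simp only [hs, if_false]
      have h1 : Tendsto (fun n : ℕ => ((n : ℝ) + 1)) atTop atTop :=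
        tendsto_atTop_add_const_right _ _ tendsto_natCast_atTop_atTop
      have h2 : 0 < (s - c) ^ 2 := by
        have := sub_ne_zero.2 hs
        positivity
      have h3 : Tendsto (fun n : ℕ => 1 + (((n : ℝ) + 1) * (s - c)) ^ 2) atTop atTop := by
        refine tendsto_atTop_add_const_left _ _ ?_
        simp_rw [mul_pow]
        exact ((tendsto_pow_atTop two_ne_zero).comp h1).atTop_mul_const h2
      simp only [one_div]
      exact h3.inv_tendsto_atTop

theorem trunc_eq_abs (k s : ℝ) (hk : 0 ≤ k) : trunc k s = (|s + k| - |s - k|) / 2 := by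
  unfold trunc
  rcases le_total s k with h | h
  · rw [min_eq_left h, abs_of_nonpos (sub_nonpos.2 h)]
    rcases le_total (-k) s with h' | h'
    · rw [max_eq_right h', abs_of_nonneg (by linarith)]; ring
    · rw [max_eq_left h', abs_of_nonpos (by linarith)]; ring
  · rw [min_eq_right h, max_eq_right (by linarith), abs_of_nonneg (by linarith : 0 ≤ s + k),
      abs_of_nonneg (sub_nonneg.2 h)]; ring

theorem hasDerivAt_sqrt_sq_add (d : ℝ) {ε : ℝ} (hε : 0 < ε) (s : ℝ) :
    HasDerivAt (fun s => √((s + d) ^ 2 + ε)) ((s + d) / √((s + d) ^ 2 + ε)) s := by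
  have h1 : HasDerivAt (fun s : ℝ => (s + d) ^ 2 + ε) (2 * (s + d)) s := by
    simpa using (((hasDerivAt_id s).add_const d).pow 2).add_const ε
  have h2 : 0 < (s + d) ^ 2 + ε := by positivity
  convert h1.sqrt h2.ne' using 1
  field_simp

theorem abs_div_sqrt_sq_add_le (s : ℝ) {ε : ℝ} (hε : 0 < ε) : |s / √(s ^ 2 + ε)| ≤ 1 := by
  have h2 : 0 < √(s ^ 2 + ε) := Real.sqrt_pos.2 (by positivity)
  rw [abs_div, abs_of_pos h2, div_le_one h2]
  exact Real.abs_le_sqrt (by linarith)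

theorem tendsto_div_sqrt_sq_add (s : ℝ) :
    Tendsto (fun n : ℕ => s / √(s ^ 2 + 1 / ((n : ℝ) + 1))) atTop (𝓝 (SignType.sign s)) := by
  by_cases hs : s = 0
  · simp [hs]
  · have h1 : Tendsto (fun n : ℕ => √(s ^ 2 + 1 / ((n : ℝ) + 1))) atTop (𝓝 |s|) := by
      have := ((tendsto_inv_nat_succ.const_add (s ^ 2)).sqrt)
      simpa [Real.sqrt_sq_eq_abs] using this
    have h2 := (tendsto_const_nhds (x := s)).div h1 (by simpa using hs)
    have h3 : (SignType.sign s : ℝ) = s / |s| := by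
      rcases lt_or_gt_of_ne hs with h | h
      · simp [sign_neg h, abs_of_neg h, div_neg, div_self hs]
      · simp [sign_pos h, abs_of_pos h, div_self hs]
    rw [h3]
    exact h2

/-- The weak gradient of a truncation. -/
theorem IsTestLimit.trunc {v : EuclideanSpace ℝ (Fin N) → ℝ}
    {g : EuclideanSpace ℝ (Fin N) → EuclideanSpace ℝ (Fin N)} (hv : IsTestLimit Ω v g)
    (hΩo : IsOpen Ω) (hΩ : volume Ω ≠ ∞) {k : ℝ} (hk : 0 < k) :
    IsWeakGradient Ω (fun x => trunc k (v x)) ({x | |v x| < k}.indicator g) := by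
  have hpos : ∀ n : ℕ, (0 : ℝ) < 1 / ((n : ℝ) + 1) := fun n => by positivity
  -- √(r² + ε) smooths |r| in T_k(s) = (|s + k| − |s − k|)/2. The limiting derivative is 1/2 at s =
  -- ±k, which is harmless because g vanishes on these two level sets.
  have key := hv.comp_of_tendsto hΩ (K := 1) (D := 0)
    (S := fun n s => (√((s + k) ^ 2 + 1 / ((n : ℝ) + 1)) - √((s + -k) ^ 2 + 1 / ((n : ℝ) + 1))) / 2)
    (S' := fun n s => ((s + k) / √((s + k) ^ 2 + 1 / ((n : ℝ) + 1)) -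
      (s + -k) / √((s + -k) ^ 2 + 1 / ((n : ℝ) + 1))) / 2)
    (T := DegElliptic.trunc k)
    (τ := fun s => ((SignType.sign (s + k) : ℝ) - (SignType.sign (s + -k) : ℝ)) / 2) ?_ ?_ ?_ ?_ ?_ ?_
  · refine key.congr (ae_eq_refl _) ?_
    filter_upwards [hv.grad_eq_zero_of_level hΩo hΩ k, hv.grad_eq_zero_of_level hΩo hΩ (-k)]
      with x h1 h2
    by_cases e1 : v x = k
    · simp [h1 e1, indicator]
    by_cases e2 : v x = -k
    · simp [h2 e2, indicator]
    by_cases h : |v x| < k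
    · rw [indicator_of_mem (by exact h)]
      have := abs_lt.1 h
      have a1 : 0 < v x + k := by linarith
      have a2 : v x + -k < 0 := by linarith
      rw [sign_pos a1, sign_neg a2]
      norm_num
    · rw [indicator_of_notMem (by exact h)]
      rcases le_abs'.1 (not_lt.1 h) with h | h
      · have h' := lt_of_le_of_ne h e2
        have a1 : v x + k < 0 := by linarith
        have a2 : v x + -k < 0 := by linarith
        rw [sign_neg a1, sign_neg a2]
        norm_num
      · have h' := lt_of_le_of_ne h (Ne.symm e1)
        have a1 : 0 < v x + k := by linarith
        have a2 : 0 < v x + -k := by linarith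
        rw [sign_pos a1, sign_pos a2]
        norm_num
  · exact fun n s => ((hasDerivAt_sqrt_sq_add k (hpos n) s).sub
      (hasDerivAt_sqrt_sq_add (-k) (hpos n) s)).div_const 2
  · intro n
    have h : ∀ d s : ℝ, √((s + d) ^ 2 + 1 / ((n : ℝ) + 1)) ≠ 0 := fun d s =>
      (Real.sqrt_pos.2 (by have := hpos n; positivity)).ne'
    exact ((Continuous.div (by fun_prop) (by fun_prop) (h k)).sub
      (Continuous.div (by fun_prop) (by fun_prop) (h (-k)))).div_const 2
  · intro n s
    have a1 := abs_le.1 (abs_div_sqrt_sq_add_le (s + k) (hpos n))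
    have a2 := abs_le.1 (abs_div_sqrt_sq_add_le (s + -k) (hpos n))
    rw [NNReal.coe_one, abs_le]
    constructor <;> linarith
  · intro n
    simp
  · intro s
    rw [trunc_eq_abs k s hk.le, sub_eq_add_neg s k]
    have h1 : ∀ d : ℝ, Tendsto (fun n : ℕ => √((s + d) ^ 2 + 1 / ((n : ℝ) + 1))) atTop
        (𝓝 |s + d|) := fun d => by
      have := ((tendsto_inv_nat_succ.const_add ((s + d) ^ 2)).sqrt)
      simpa [Real.sqrt_sq_eq_abs] using this
    exact ((h1 k).sub (h1 (-k))).div_const 2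
  · exact fun s => ((tendsto_div_sqrt_sq_add (s + k)).sub
      (tendsto_div_sqrt_sq_add (s + -k))).div_const 2

end DegElliptic

/-! ### Algebra of truncations and the generalized gradient. -/

namespace DegElliptic

variable {N : ℕ} {Ω : Set (EuclideanSpace ℝ (Fin N))}

theorem continuous_trunc (k : ℝ) : Continuous (trunc k) := by
  unfold trunc
  fun_prop

theorem abs_trunc_le {k : ℝ} (hk : 0 ≤ k) (s : ℝ) : |trunc k s| ≤ k := by
  unfold trunc
  exact abs_le.2 ⟨le_max_left _ _, max_le (by linarith) (min_le_right _ _)⟩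

theorem trunc_of_abs_le {k s : ℝ} (h : |s| ≤ k) : trunc k s = s := by
  unfold trunc
  rw [min_eq_left (abs_le.1 h).2, max_eq_right (abs_le.1 h).1]

theorem trunc_of_le {k s : ℝ} (hk : 0 ≤ k) (h : k ≤ s) : trunc k s = k := by
  unfold trunc
  rw [min_eq_right h, max_eq_right (by linarith)]

theorem trunc_of_le_neg {k s : ℝ} (hk : 0 ≤ k) (h : s ≤ -k) : trunc k s = -k := by
  unfold trunc
  rw [min_eq_left (by linarith), max_eq_left h]

theorem trunc_trunc {k M : ℝ} (hk : 0 ≤ k) (hkM : k ≤ M) (s : ℝ) :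
    trunc k (trunc M s) = trunc k s := by
  rcases le_total |s| M with h | h
  · rw [trunc_of_abs_le h]
  · rcases le_abs'.1 h with h | h
    · rw [trunc_of_le_neg (by linarith) h, trunc_of_le_neg hk (by linarith),
        trunc_of_le_neg hk (by linarith)]
    · rw [trunc_of_le (by linarith) h, trunc_of_le hk (by linarith),
        trunc_of_le hk (by linarith)]

theorem trunc_of_abs_trunc_lt {k s : ℝ} (hk : 0 ≤ k) (h : |trunc k s| < k) : |s| < k := by
  by_contra! h'
  rcases le_abs'.1 h' with h' | h'
  · rw [trunc_of_le_neg hk h', abs_neg, abs_of_nonneg hk] at h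
    exact h.false
  · rw [trunc_of_le hk h', abs_of_nonneg hk] at h
    exact h.false

theorem abs_trunc_lt_iff {k M : ℝ} (hk : 0 ≤ k) (hkM : k ≤ M) (s : ℝ) :
    |trunc M s| < k ↔ |s| < k := by
  constructor
  · intro h
    have := trunc_of_abs_trunc_lt (hk.trans hkM) (h.trans_le hkM)
    rwa [trunc_of_abs_le this.le] at h
  · intro h
    rwa [trunc_of_abs_le (h.le.trans hkM)]

/-- For |s| ≥ M + k, both differences lie at distance at least k from 0 on the same side. So u may
be replaced by `T_{M+k}(u)` in `T_k(u - φ)`, although u itself need not have a weak gradient. -/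
theorem trunc_trunc_sub {k M c s : ℝ} (hk : 0 ≤ k) (hM : 0 ≤ M) (hc : |c| ≤ M) :
    trunc k (trunc (M + k) s - c) = trunc k (s - c) := by
  have hc' := abs_le.1 hc
  rcases le_total |s| (M + k) with h | h
  · rw [trunc_of_abs_le h]
  · rcases le_abs'.1 h with h | h
    · rw [trunc_of_le_neg (by linarith) h, trunc_of_le_neg hk (by linarith),
        trunc_of_le_neg hk (by linarith)]
    · rw [trunc_of_le (by linarith) h, trunc_of_le hk (by linarith),
        trunc_of_le hk (by linarith)]

theorem abs_trunc_sub_lt_iff {k M c s : ℝ} (hM : 0 ≤ M) (hc : |c| ≤ M) :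
    |trunc (M + k) s - c| < k ↔ |s - c| < k := by
  have hc' := abs_le.1 hc
  constructor
  · intro h
    have h' := abs_lt.1 h
    have := trunc_of_abs_trunc_lt (s := s) (by linarith : 0 ≤ M + k)
      (abs_lt.2 ⟨by linarith, by linarith⟩)
    rwa [trunc_of_abs_le this.le] at h
  · intro h
    have h' := abs_lt.1 h
    rwa [trunc_of_abs_le (abs_le.2 ⟨by linarith, by linarith⟩)]

theorem IsTestLimit.congr_grad {v : EuclideanSpace ℝ (Fin N) → ℝ}
    {g g' : EuclideanSpace ℝ (Fin N) → EuclideanSpace ℝ (Fin N)} (h : IsTestLimit Ω v g)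
    (hg : g =ᵐ[volume.restrict Ω] g') : IsTestLimit Ω v g' where
  int := h.int
  int_grad := h.int_grad.congr hg
  approx := by
    obtain ⟨φ, hφ, t1, t2⟩ := h.approx
    refine ⟨φ, hφ, t1, t2.congr fun n => lintegral_congr_ae ?_⟩
    filter_upwards [hg] with x hx
    rw [hx]

/-- The chain rule yields the set {|u| < k}. It may be enlarged to {|u| ≤ k} because g vanishes on
the level sets ±k. -/
theorem IsTestLimit.isWeakGradient_trunc_of_lt {u : EuclideanSpace ℝ (Fin N) → ℝ}
    {g : EuclideanSpace ℝ (Fin N) → EuclideanSpace ℝ (Fin N)} {k M : ℝ}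
    (h : IsTestLimit Ω (fun x => DegElliptic.trunc M (u x)) g) (hΩo : IsOpen Ω)
    (hΩ : volume Ω ≠ ∞) (hk : 0 < k) (hkM : k < M) :
    IsWeakGradient Ω (fun x => DegElliptic.trunc k (u x)) ({x | |u x| ≤ k}.indicator g) := by
  refine (h.trunc hΩo hΩ hk).congr
    (Eventually.of_forall fun x => trunc_trunc hk.le hkM.le _) ?_
  filter_upwards [h.grad_eq_zero_of_level hΩo hΩ k, h.grad_eq_zero_of_level hΩo hΩ (-k)]
    with x h1 h2
  by_cases hx : |u x| < k
  · rw [indicator_of_mem (by exact (abs_trunc_lt_iff hk.le hkM.le _).2 hx),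
      indicator_of_mem (by exact hx.le)]
  · rw [indicator_of_notMem (by rwa [mem_ofPred, abs_trunc_lt_iff hk.le hkM.le])]
    by_cases hx' : |u x| ≤ k
    · rw [indicator_of_mem (by exact hx')]
      have e := le_antisymm hx' (not_lt.1 hx)
      rw [trunc_of_abs_le (by linarith)] at h1 h2
      rcases abs_eq hk.le |>.1 e with e | e
      · exact (h1 e).symm
      · exact (h2 e).symm
    · rw [indicator_of_notMem (by exact hx')]

theorem exists_isGenGradient {p : ℝ} (hp : 1 ≤ p) (hΩo : IsOpen Ω) (hΩ : volume Ω ≠ ∞)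
    {u : EuclideanSpace ℝ (Fin N) → ℝ}
    (ht : ∀ k : ℝ, 0 < k → MemW01p Ω p (fun x => trunc k (u x))) :
    ∃ G, IsGenGradient Ω u G := by
  have hpos : ∀ n : ℕ, (0 : ℝ) < n + 1 := fun n => by positivity
  choose g hg _ hgt using fun n : ℕ => (ht (n + 1) (hpos n)).exists_isTestLimit hp hΩ
  have hcons : ∀ᵐ x ∂(volume.restrict Ω), ∀ m n : ℕ, m < n → |u x| ≤ m + 1 → g m x = g n x := by
    rw [ae_all_iff]; intro m; rw [ae_all_iff]; intro n
    by_cases hmn : m < n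
    · have h1 := (hgt n).isWeakGradient_trunc_of_lt hΩo hΩ (hpos m)
        (by have : (m : ℝ) < n := by exact_mod_cast hmn
            linarith)
      filter_upwards [(hg m).ae_eq hΩo h1] with x hx _ hux
      rw [hx, indicator_of_mem (by exact hux)]
    · exact Eventually.of_forall fun x h => absurd h hmn
  have hcons' : ∀ᵐ x ∂(volume.restrict Ω), ∀ m n : ℕ, m ≤ n → |u x| ≤ m + 1 → g m x = g n x := by
    filter_upwards [hcons] with x hx m n hmn hux
    rcases hmn.eq_or_lt with rfl | h
    · rfl
    · exact hx m n h hux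
  have hlt : ∀ x, |u x| ≤ (⌈|u x|⌉₊ : ℝ) + 1 := fun x => (Nat.le_ceil _).trans (by linarith)
  -- `g m` belongs to the height m + 1, so this index covers the value u x, and every larger index
  -- gives the same vector. Measurability follows since the sequence is eventually constant at
  -- almost every point.
  refine ⟨fun x => g ⌈|u x|⌉₊ x, ?_, fun k hk => ?_⟩
  · refine aestronglyMeasurable_of_tendsto_ae atTop
      (fun n => (hgt n).int_grad.aestronglyMeasurable) ?_
    filter_upwards [hcons'] with x hx
    refine tendsto_const_nhds.congr' ?_
    filter_upwards [eventually_ge_atTop ⌈|u x|⌉₊] with n hn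
    exact hx _ _ hn (hlt x)
  · have h1 := (hgt ⌈k⌉₊).isWeakGradient_trunc_of_lt hΩo hΩ hk
      ((Nat.le_ceil k).trans_lt (lt_add_one _))
    refine h1.congr (ae_eq_refl _) ?_
    filter_upwards [hcons'] with x hx
    by_cases hux : |u x| ≤ k
    · rw [indicator_of_mem (by exact hux), indicator_of_mem (by exact hux)]
      exact (hx _ _ (Nat.ceil_mono hux) (hlt x)).symm
    · rw [indicator_of_notMem (by exact hux), indicator_of_notMem (by exact hux)]

theorem isGenGradient_genGrad {u : EuclideanSpace ℝ (Fin N) → ℝ}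
    (h : ∃ G, IsGenGradient Ω u G) : IsGenGradient Ω u (genGrad Ω u) := by
  have : genGrad Ω u = h.choose := by simp [genGrad, h]
  rw [this]
  exact h.choose_spec

theorem IsGenGradient.isTestLimit {p : ℝ} (hp : 1 ≤ p) (hΩo : IsOpen Ω) (hΩ : volume Ω ≠ ∞)
    {u : EuclideanSpace ℝ (Fin N) → ℝ} {G : EuclideanSpace ℝ (Fin N) → EuclideanSpace ℝ (Fin N)}
    (hG : IsGenGradient Ω u G) {k : ℝ} (hk : 0 < k)
    (ht : MemW01p Ω p (fun x => trunc k (u x))) :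
    IsTestLimit Ω (fun x => trunc k (u x)) ({x | |u x| ≤ k}.indicator G) := by
  obtain ⟨g, hg, _, hgt⟩ := ht.exists_isTestLimit hp hΩ
  exact hgt.congr_grad (hg.ae_eq hΩo (hG.2 k hk))

theorem IsGenGradient.memLp {p : ℝ} (hp : 1 ≤ p) (hΩo : IsOpen Ω) (hΩ : volume Ω ≠ ∞)
    {u : EuclideanSpace ℝ (Fin N) → ℝ} {G : EuclideanSpace ℝ (Fin N) → EuclideanSpace ℝ (Fin N)}
    (hG : IsGenGradient Ω u G) {k : ℝ} (hk : 0 < k)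
    (ht : MemW01p Ω p (fun x => trunc k (u x))) :
    MemLp ({x | |u x| ≤ k}.indicator G) (ENNReal.ofReal p) (volume.restrict Ω) := by
  obtain ⟨g, hg, hgp, _⟩ := ht.exists_isTestLimit hp hΩ
  exact hgp.ae_eq (hg.ae_eq hΩo (hG.2 k hk))

/-- The weak gradient of `T_k(u - φ)` for a bounded `φ` that is a limit of test functions. -/
theorem IsGenGradient.weakGrad_trunc_sub {p : ℝ} (hp : 1 ≤ p) (hΩo : IsOpen Ω)
    (hΩ : volume Ω ≠ ∞) {u φ : EuclideanSpace ℝ (Fin N) → ℝ}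
    {G g : EuclideanSpace ℝ (Fin N) → EuclideanSpace ℝ (Fin N)} (hG : IsGenGradient Ω u G)
    (ht : ∀ k : ℝ, 0 < k → MemW01p Ω p (fun x => trunc k (u x))) (hφ : IsTestLimit Ω φ g)
    {M : ℝ} (hM : 0 < M) (hφM : ∀ x, |φ x| ≤ M) {k : ℝ} (hk : 0 < k) :
    weakGrad Ω (fun x => trunc k (u x - φ x)) =ᵐ[volume.restrict Ω]
      {x | |u x - φ x| < k}.indicator (fun x => G x - g x) := by
  have hMk : 0 < M + k := by linarith
  have h1 := (hG.isTestLimit hp hΩo hΩ hMk (ht _ hMk)).sub hφ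
  have h2 := h1.trunc hΩo hΩ hk
  simp only [trunc_trunc_sub hk.le hM.le (hφM _), abs_trunc_sub_lt_iff hM.le (hφM _)] at h2
  refine (h2.weakGrad_ae_eq hΩo).trans (Eventually.of_forall fun x => ?_)
  by_cases hx : |u x - φ x| < k
  · have a := abs_lt.1 hx
    have b := abs_le.1 (hφM x)
    have hu : |u x| ≤ M + k := abs_le.2 ⟨by linarith, by linarith⟩
    have m1 : x ∈ {x | |u x| ≤ M + k} := hu
    have m2 : x ∈ {x | |u x - φ x| < k} := hx
    rw [indicator_of_mem m2, indicator_of_mem m2, indicator_of_mem m1]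
  · rw [indicator_of_notMem (by exact hx), indicator_of_notMem (by exact hx)]

end DegElliptic

/-! ### Pointwise lower bound for the sum of the two entropy integrands. -/

namespace DegElliptic

theorem rpow_mul_add_le {β l r q : ℝ} (hβ : 0 ≤ β) (hl : 0 ≤ l) (hr : 0 ≤ r) (hq : 0 ≤ q) :
    (β * (l + r)) ^ q ≤ (2 * β) ^ q * (l ^ q + r ^ q) := by
  have h1 : β * (l + r) ≤ (2 * β) * max l r := by
    have := mul_le_mul_of_nonneg_left
      (add_le_add (le_max_left l r) (le_max_right l r)) hβ
    linarith
  calc (β * (l + r)) ^ q ≤ ((2 * β) * max l r) ^ q :=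
        Real.rpow_le_rpow (by positivity) h1 hq
    _ = (2 * β) ^ q * (max l r) ^ q :=
        Real.mul_rpow (by positivity) (le_max_of_le_left hl)
    _ ≤ _ := by
        gcongr
        rcases max_choice l r with h | h <;> rw [h]
        · linarith [Real.rpow_nonneg hr q]
        · linarith [Real.rpow_nonneg hl q]

/-- Young's inequality with the factors 1/p and 1/q dropped. The growth condition turns ‖a ξ‖^q into
‖ξ‖^p because (p − 1)q = p. -/
theorem norm_mul_norm_le {E : Type*} [NormedAddCommGroup E] {a : E → E} {p q β l : ℝ}
    (hpq : q.HolderConjugate p) (hβ : 0 ≤ β) (hl : 0 ≤ l)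
    (hgr : ∀ ξ, ‖a ξ‖ ≤ β * (l + ‖ξ‖ ^ (p - 1))) (ξ η : E) :
    ‖a ξ‖ * ‖η‖ ≤ (2 * β) ^ q * (l ^ q + ‖ξ‖ ^ p) + ‖η‖ ^ p := by
  have hp1 := hpq.symm.lt
  have hq1 := hpq.lt
  have h1 := Real.young_inequality_of_nonneg (norm_nonneg (a ξ)) (norm_nonneg η) hpq
  have h2 : ‖a ξ‖ ^ q / q ≤ ‖a ξ‖ ^ q := div_le_self (by positivity) hq1.le
  have h3 : ‖η‖ ^ p / p ≤ ‖η‖ ^ p := div_le_self (by positivity) hp1.le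
  have h4 : ‖a ξ‖ ^ q ≤ (β * (l + ‖ξ‖ ^ (p - 1))) ^ q :=
    Real.rpow_le_rpow (norm_nonneg _) (hgr ξ) (by linarith)
  have h5 := rpow_mul_add_le (q := q) hβ hl (Real.rpow_nonneg (norm_nonneg ξ) (p - 1))
    (by linarith)
  rw [← Real.rpow_mul (norm_nonneg ξ), show (p - 1) * q = p by
    rw [hpq.symm.sub_one_mul_conj]] at h5
  linarith

section Pointwise

variable {E : Type*} [NormedAddCommGroup E] [InnerProductSpace ℝ E]
  {a : E → E} {p q β l : ℝ}

/-- The integrand of the entropy inequality for the test function `T_n(v)` at level `k`, where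
`u = s`, `v = t`, `∇u = ξ` and `∇v = η`. -/
noncomputable def crossFlux (a : E → E) (b : ℝ → ℝ) (n k s t : ℝ) (ξ η : E) : ℝ :=
  if |s - trunc n t| < k then inner ℝ (b s • a ξ) (ξ - if |t| ≤ n then η else 0) else 0

/-- The part of the lower bound of `crossFlux` that is concentrated where `u` is near `n`. -/
noncomputable def layerTerm (a : E → E) (b : ℝ → ℝ) (p q l B L C n k s : ℝ) (ξ : E) : ℝ :=
  (if n < s ∧ s < n + k then C * B * l ^ q else 0) +
    (if n - k < s ∧ s < n + k then (C + 1) * inner ℝ (b s • a ξ) ξ else 0) +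
    L * k * (if n - k < s ∧ s ≤ n then ‖ξ‖ ^ p else 0)

theorem trunc_of_nonneg_of_le {n s : ℝ} (hs : 0 ≤ s) (h : s ≤ n) : trunc n s = s :=
  trunc_of_abs_le (by rwa [abs_of_nonneg hs])

variable {b : ℝ → ℝ} {B L n k s t : ℝ}

theorem layerTerm_nonneg {C : ℝ} (hC : 0 ≤ C) (hB : 0 ≤ B) (hL : 0 ≤ L) (hk : 0 ≤ k) (hl : 0 ≤ l)
    (hb0 : ∀ s, 0 ≤ b s) {ξ : E} (hco : 0 ≤ inner ℝ (a ξ) ξ) :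
    0 ≤ layerTerm a b p q l B L C n k s ξ := by
  have := hb0 s
  have hin : 0 ≤ inner ℝ (b s • a ξ) ξ := by
    rw [real_inner_smul_left]
    positivity
  unfold layerTerm
  refine add_nonneg (add_nonneg ?_ ?_) (mul_nonneg (by positivity) ?_) <;>
    split_ifs <;> positivity

/-- The estimate of the mixed term where one argument is above the level `n` and the other one is
below it. -/
theorem layer_estimate (hpq : q.HolderConjugate p) (hβ : 0 ≤ β) (hl : 0 ≤ l)
    (hgr : ∀ ξ, ‖a ξ‖ ≤ β * (l + ‖ξ‖ ^ (p - 1))) (hco : ∀ ξ, ‖ξ‖ ^ p ≤ inner ℝ (a ξ) ξ)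
    (hb0 : ∀ s, 0 ≤ b s) (hbB : ∀ s, b s ≤ B) (hL : 0 ≤ L)
    (hbL : ∀ s t, |b s - b t| ≤ L * |s - t|) (hns : n < s) (htn : t ≤ n) (hst : |s - t| < k)
    (ξ η : E) :
    b s * (‖a ξ‖ * ‖η‖) ≤ layerTerm a b p q l B L ((2 * β) ^ q) n k s ξ +
      layerTerm a b p q l B L ((2 * β) ^ q) n k t η := by
  have hst' := abs_lt.1 hst
  have hk : 0 < k := (abs_nonneg _).trans_lt hst
  set C := (2 * β) ^ q with hC
  have hC0 : 0 ≤ C := by positivity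
  have e1 : layerTerm a b p q l B L C n k s ξ = C * B * l ^ q + (C + 1) * (b s * inner ℝ (a ξ) ξ) := by
    unfold layerTerm
    rw [if_pos ⟨hns, by linarith⟩, if_pos ⟨by linarith, by linarith⟩,
      if_neg (fun h => absurd h.2 (not_le.2 hns)), real_inner_smul_left]
    ring
  have e2 : layerTerm a b p q l B L C n k t η =
      (C + 1) * (b t * inner ℝ (a η) η) + L * k * ‖η‖ ^ p := by
    unfold layerTerm
    rw [if_neg (fun h => absurd h.1 (not_lt.2 htn)), if_pos ⟨by linarith, by linarith⟩,
      if_pos ⟨by linarith, htn⟩, real_inner_smul_left]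
    ring
  rw [e1, e2]
  -- Weight C on the energy at s and weight 1 on the energy at t would suffice. The common weight C
  -- + 1 lets one `layerTerm` play either role.
  have hY := mul_le_mul_of_nonneg_left (norm_mul_norm_le hpq hβ hl hgr ξ η) (hb0 s)
  have hlq : 0 ≤ l ^ q := by positivity
  have hξp : 0 ≤ ‖ξ‖ ^ p := by positivity
  have hηp : 0 ≤ ‖η‖ ^ p := by positivity
  have h1 : b s * (C * l ^ q) ≤ C * B * l ^ q := by
    have := mul_le_mul_of_nonneg_right (hbB s) (by positivity : 0 ≤ C * l ^ q)
    linarith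
  have h2 : b s * ‖ξ‖ ^ p ≤ b s * inner ℝ (a ξ) ξ := mul_le_mul_of_nonneg_left (hco ξ) (hb0 s)
  have h3 : b t * ‖η‖ ^ p ≤ b t * inner ℝ (a η) η := mul_le_mul_of_nonneg_left (hco η) (hb0 t)
  -- The energy at t is available only with its own weight b t, so the weights are exchanged at the
  -- price Lk.
  have h4 : b s * ‖η‖ ^ p ≤ b t * ‖η‖ ^ p + L * k * ‖η‖ ^ p := by
    have h5 := (abs_le.1 (hbL s t)).2
    have h6 : L * |s - t| ≤ L * k := mul_le_mul_of_nonneg_left hst.le hL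
    have := mul_le_mul_of_nonneg_right (by linarith : b s ≤ b t + L * k) hηp
    linarith
  have h7 : 0 ≤ b s * ‖ξ‖ ^ p := mul_nonneg (hb0 s) hξp
  have h8 : 0 ≤ b t * ‖η‖ ^ p := mul_nonneg (hb0 t) hηp
  have h9 := mul_le_mul_of_nonneg_left h2 hC0
  have h10 := mul_le_mul_of_nonneg_left h3 hC0
  have h11 := mul_nonneg hC0 h8
  nlinarith

/-- Where v > n, the gradient of `T_n(v)` vanishes and only the coercive term remains. -/
theorem crossFlux_nonneg_of_lt (hnt : n < t)
    (hb0 : ∀ s, 0 ≤ b s) {ξ : E} (hco : 0 ≤ inner ℝ (a ξ) ξ) (η : E) :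
    0 ≤ crossFlux a b n k s t ξ η := by
  unfold crossFlux
  rw [if_neg (not_le.2 (hnt.trans_le (le_abs_self t))), sub_zero, real_inner_smul_left]
  have := hb0 s
  split_ifs <;> positivity

/-- Only the first summand can be negative: in the second, the argument that gets truncated lies
above n. The loss is the mixed term of `layer_estimate`. -/
theorem crossFlux_add_crossFlux_of_lt_of_le (hpq : q.HolderConjugate p) (hβ : 0 ≤ β) (hl : 0 ≤ l)
    (hgr : ∀ ξ, ‖a ξ‖ ≤ β * (l + ‖ξ‖ ^ (p - 1))) (hco : ∀ ξ, ‖ξ‖ ^ p ≤ inner ℝ (a ξ) ξ)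
    (hb0 : ∀ s, 0 ≤ b s) (hbB : ∀ s, b s ≤ B) (hL : 0 ≤ L)
    (hbL : ∀ s t, |b s - b t| ≤ L * |s - t|) (hk : 0 ≤ k) (ht : 0 ≤ t) (hns : n < s) (htn : t ≤ n)
    (ξ η : E) :
    -(layerTerm a b p q l B L ((2 * β) ^ q) n k s ξ +
      layerTerm a b p q l B L ((2 * β) ^ q) n k t η) ≤
      crossFlux a b n k s t ξ η + crossFlux a b n k t s η ξ := by
  have hco0 : ∀ ξ, 0 ≤ inner ℝ (a ξ) ξ := fun ξ => (by positivity : 0 ≤ ‖ξ‖ ^ p).trans (hco ξ)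
  have hB : 0 ≤ B := (hb0 0).trans (hbB 0)
  have hC : 0 ≤ (2 * β) ^ q := by positivity
  have h2 : 0 ≤ crossFlux a b n k t s η ξ := crossFlux_nonneg_of_lt hns hb0 (hco0 η) ξ
  have h0s := layerTerm_nonneg (p := p) (q := q) (n := n) (s := s) hC hB hL hk hl hb0 (hco0 ξ)
  have h0t := layerTerm_nonneg (p := p) (q := q) (n := n) (s := t) hC hB hL hk hl hb0 (hco0 η)
  by_cases hst : |s - t| < k
  · have h1 : -(b s * (‖a ξ‖ * ‖η‖)) ≤ crossFlux a b n k s t ξ η := by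
      unfold crossFlux
      rw [trunc_of_nonneg_of_le ht htn, if_pos hst, if_pos (by rwa [abs_of_nonneg ht]),
        real_inner_smul_left, inner_sub_right, mul_sub]
      have h3 := mul_le_mul_of_nonneg_left (real_inner_le_norm (a ξ) η) (hb0 s)
      have h4 := mul_nonneg (hb0 s) (hco0 ξ)
      linarith
    have h3 := layer_estimate hpq hβ hl hgr hco hb0 hbB hL hbL hns htn hst ξ η
    linarith
  · have h1 : crossFlux a b n k s t ξ η = 0 := by
      unfold crossFlux
      rw [trunc_of_nonneg_of_le ht htn, if_neg hst]
    linarith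

/-- With b s as common weight, the sum is a monotonicity term plus (b s − b t)⟨a η, ξ − η⟩. The
error vanishes for s = t; excluding that case is what later makes its integral tend to 0 with k. -/
theorem crossFlux_add_crossFlux_of_le_of_le (hmono : ∀ ξ η, 0 ≤ inner ℝ (a ξ - a η) (ξ - η))
    (hb0 : ∀ s, 0 ≤ b s) (hL : 0 ≤ L)
    (hbL : ∀ s t, |b s - b t| ≤ L * |s - t|) (hs : 0 ≤ s) (ht : 0 ≤ t) (hsn : s ≤ n) (htn : t ≤ n)
    (ξ η : E) :
    -(L * k * (if s ≠ t ∧ |s - t| < k then ‖a η‖ * (‖ξ‖ + ‖η‖) else 0)) ≤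
      crossFlux a b n k s t ξ η + crossFlux a b n k t s η ξ := by
  unfold crossFlux
  rw [trunc_of_nonneg_of_le ht htn, trunc_of_nonneg_of_le hs hsn, abs_of_nonneg hs,
    abs_of_nonneg ht, if_pos hsn, if_pos htn, abs_sub_comm t s]
  by_cases hst : |s - t| < k
  · have hk : 0 < k := (abs_nonneg _).trans_lt hst
    rw [if_pos hst, if_pos hst]
    have e : inner ℝ (b s • a ξ) (ξ - η) + inner ℝ (b t • a η) (η - ξ) =
        b s * inner ℝ (a ξ - a η) (ξ - η) + (b s - b t) * inner ℝ (a η) (ξ - η) := by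
      rw [real_inner_smul_left, real_inner_smul_left, inner_sub_left, ← neg_sub ξ η,
        inner_neg_right]
      ring
    rw [e]
    have h1 := mul_nonneg (hb0 s) (hmono ξ η)
    by_cases hne : s = t
    · rw [hne] at h1 ⊢
      simpa using h1
    · rw [if_pos ⟨hne, hst⟩]
      have h2 : |(b s - b t) * inner ℝ (a η) (ξ - η)| ≤ L * k * (‖a η‖ * (‖ξ‖ + ‖η‖)) := by
        rw [abs_mul]
        have h3 : |b s - b t| ≤ L * k :=
          (hbL s t).trans (mul_le_mul_of_nonneg_left hst.le hL)
        have h4 : |inner ℝ (a η) (ξ - η)| ≤ ‖a η‖ * (‖ξ‖ + ‖η‖) :=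
          (abs_real_inner_le_norm _ _).trans (by gcongr; exact norm_sub_le _ _)
        gcongr
      linarith [(abs_le.1 h2).1]
  · rw [if_neg hst, if_neg hst, if_neg (fun h => hst h.2)]
    simp

/-- The pointwise lower bound of the sum of the two integrands. -/
theorem crossFlux_add_crossFlux_ge (hpq : q.HolderConjugate p) (hβ : 0 ≤ β) (hl : 0 ≤ l)
    (hgr : ∀ ξ, ‖a ξ‖ ≤ β * (l + ‖ξ‖ ^ (p - 1))) (hco : ∀ ξ, ‖ξ‖ ^ p ≤ inner ℝ (a ξ) ξ)
    (hmono : ∀ ξ η, 0 ≤ inner ℝ (a ξ - a η) (ξ - η))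
    (hb0 : ∀ s, 0 ≤ b s) (hbB : ∀ s, b s ≤ B) (hL : 0 ≤ L)
    (hbL : ∀ s t, |b s - b t| ≤ L * |s - t|) (hk : 0 ≤ k) (hs : 0 ≤ s) (ht : 0 ≤ t)
    {M : ℝ} (hnM : n ≤ M) (ξ η : E) :
    -(L * k * (if (s ≤ M ∧ t ≤ M) ∧ s ≠ t ∧ |s - t| < k then ‖a η‖ * (‖ξ‖ + ‖η‖) else 0) +
      (layerTerm a b p q l B L ((2 * β) ^ q) n k s ξ +
        layerTerm a b p q l B L ((2 * β) ^ q) n k t η)) ≤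
      crossFlux a b n k s t ξ η + crossFlux a b n k t s η ξ := by
  have hco0 : ∀ ξ, 0 ≤ inner ℝ (a ξ) ξ := fun ξ => (by positivity : 0 ≤ ‖ξ‖ ^ p).trans (hco ξ)
  have hB : 0 ≤ B := (hb0 0).trans (hbB 0)
  have hC : 0 ≤ (2 * β) ^ q := by positivity
  have h0s := layerTerm_nonneg (p := p) (q := q) (n := n) (s := s) hC hB hL hk hl hb0 (hco0 ξ)
  have h0t := layerTerm_nonneg (p := p) (q := q) (n := n) (s := t) hC hB hL hk hl hb0 (hco0 η)
  have hD : 0 ≤ L * k *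
      (if (s ≤ M ∧ t ≤ M) ∧ s ≠ t ∧ |s - t| < k then ‖a η‖ * (‖ξ‖ + ‖η‖) else 0) :=
    mul_nonneg (by positivity) (by split_ifs <;> positivity)
  rcases le_or_gt s n with hsn | hsn <;> rcases le_or_gt t n with htn | htn
  · have h1 := crossFlux_add_crossFlux_of_le_of_le (k := k) hmono hb0 hL hbL hs ht hsn htn ξ η
    -- Bounding the arguments by M instead of n lets one error function serve all levels n ≤ M.
    have e : (if (s ≤ M ∧ t ≤ M) ∧ s ≠ t ∧ |s - t| < k then ‖a η‖ * (‖ξ‖ + ‖η‖) else 0) =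
        if s ≠ t ∧ |s - t| < k then ‖a η‖ * (‖ξ‖ + ‖η‖) else 0 := by
      simp [hsn.trans hnM, htn.trans hnM]
    rw [e] at *
    linarith
  · have h1 := crossFlux_add_crossFlux_of_lt_of_le hpq hβ hl hgr hco hb0 hbB hL hbL hk hs htn hsn
      η ξ
    linarith
  · have h1 := crossFlux_add_crossFlux_of_lt_of_le hpq hβ hl hgr hco hb0 hbB hL hbL hk ht hsn htn
      ξ η
    linarith
  · have h1 := crossFlux_nonneg_of_lt (k := k) (s := s) htn hb0 (hco0 ξ) η
    have h2 := crossFlux_nonneg_of_lt (k := k) (s := t) hsn hb0 (hco0 η) ξ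
    linarith

end Pointwise

end DegElliptic

/-! ### Consequences of the definition: integrability, admissible tests, energy on strips. -/

namespace DegElliptic

variable {N : ℕ} {Ω : Set (EuclideanSpace ℝ (Fin N))}

theorem integrable_ite {α : Type*} [MeasurableSpace α] {μ : Measure α} {F : α → ℝ}
    {P : α → Prop} [DecidablePred P] (hF : Integrable F μ) (hP : NullMeasurableSet {x | P x} μ) :
    Integrable (fun x => if P x then F x else 0) μ :=
  (hF.indicator₀ hP).congr (Eventually.of_forall fun x => by simp [indicator])

theorem memW01p_zero {p : ℝ} : MemW01p Ω p (fun _ => 0) := by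
  refine ⟨MemLp.zero', fun _ => 0, isWeakGradient_zero, MemLp.zero', fun _ _ => 0, fun _ =>
    ⟨contDiff_const, HasCompactSupport.zero, by simp [tsupport, Function.support]⟩, by simp, ?_⟩
  simp [gradient_fun_const]

theorem memLp_top_trunc {u : EuclideanSpace ℝ (Fin N) → ℝ} {n : ℝ} (hn : 0 ≤ n)
    (hu : AEMeasurable u (volume.restrict Ω)) :
    MemLp (fun x => trunc n (u x)) ∞ (volume.restrict Ω) :=
  memLp_top_of_bound ((continuous_trunc n).comp_aestronglyMeasurable hu.aestronglyMeasurable) n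
    (Eventually.of_forall fun _ => abs_trunc_le hn _)

/-- The right-hand side `h(u) f`, as a real function. -/
def source (h : ℝ≥0 → ℝ≥0∞) (f u : EuclideanSpace ℝ (Fin N) → ℝ)
    (x : EuclideanSpace ℝ (Fin N)) : ℝ :=
  (h (u x).toNNReal).toReal * f x

variable {p q : ℝ} {A : EuclideanSpace ℝ (Fin N) → EuclideanSpace ℝ (Fin N) →
  EuclideanSpace ℝ (Fin N)} {b : ℝ → ℝ} {h : ℝ≥0 → ℝ≥0∞}
  {f u v : EuclideanSpace ℝ (Fin N) → ℝ}

theorem IsEntropySolution.isGenGradient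
    {a : EuclideanSpace ℝ (Fin N) → ℝ → EuclideanSpace ℝ (Fin N) → EuclideanSpace ℝ (Fin N)}
    (hu : IsEntropySolution Ω p a h f u) (hp : 1 ≤ p) (hΩo : IsOpen Ω) (hΩ : volume Ω ≠ ∞) :
    IsGenGradient Ω u (genGrad Ω u) :=
  isGenGradient_genGrad (exists_isGenGradient hp hΩo hΩ hu.trunc_mem)

theorem nullMeasurableSet_abs_le (hu : AEMeasurable u (volume.restrict Ω)) (k : ℝ) :
    NullMeasurableSet {x | |u x| ≤ k} (volume.restrict Ω) :=
  nullMeasurableSet_le (continuous_abs.measurable.comp_aemeasurable hu) aemeasurable_const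

theorem nullMeasurableSet_gt (hu : AEMeasurable u (volume.restrict Ω)) (k : ℝ) :
    NullMeasurableSet {x | k < u x} (volume.restrict Ω) :=
  nullMeasurableSet_lt aemeasurable_const hu

theorem nullMeasurableSet_le_const (hu : AEMeasurable u (volume.restrict Ω)) (k : ℝ) :
    NullMeasurableSet {x | u x ≤ k} (volume.restrict Ω) :=
  nullMeasurableSet_le hu aemeasurable_const

theorem IsEntropySolution.memLp_flux (hu : IsEntropySolution Ω p (fun x s ξ => b s • A x ξ) h f u)
    (hp : 1 ≤ p) (hΩo : IsOpen Ω) (hΩ : volume Ω ≠ ∞) {k : ℝ} (hk : 0 < k) :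
    MemLp ({x | |u x| ≤ k}.indicator fun x => b (u x) • A x (genGrad Ω u x))
      (ENNReal.ofReal (p / (p - 1))) (volume.restrict Ω) := by
  have hG := hu.isGenGradient hp hΩo hΩ
  have h1 := (hG.2 k hk).weakGrad_ae_eq hΩo
  have h2 := hu.flux_mem k hk
  have hset := nullMeasurableSet_abs_le hu.meas k
  have e : ({x | |u x| ≤ k}.indicator fun x => b (u x) • A x (genGrad Ω u x))
      =ᵐ[volume.restrict Ω] {x | |u x| ≤ k}.indicator
        (fun x => b (trunc k (u x)) • A x (weakGrad Ω (fun y => trunc k (u y)) x)) := by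
    filter_upwards [h1] with x hx
    by_cases hux : |u x| ≤ k
    · have m : x ∈ {x | |u x| ≤ k} := hux
      rw [indicator_of_mem m, indicator_of_mem m, hx, indicator_of_mem m, trunc_of_abs_le hux]
    · rw [indicator_of_notMem (by exact hux), indicator_of_notMem (by exact hux)]
  refine h2.mono ((h2.aestronglyMeasurable.indicator₀ hset).congr e.symm) ?_
  filter_upwards [e] with x hx
  rw [hx]
  exact norm_indicator_le_norm_self _ _

/-- On [−k, k] the continuous positive b has a positive minimum, so the flux can be divided by b(u).
Measurability of A(x, ∇u) is obtained by the same division. -/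
theorem IsEntropySolution.memLp_operator
    (hu : IsEntropySolution Ω p (fun x s ξ => b s • A x ξ) h f u)
    (hp : 1 ≤ p) (hΩo : IsOpen Ω) (hΩ : volume Ω ≠ ∞) (hbc : Continuous b) (hb0 : ∀ s, 0 < b s)
    {k : ℝ} (hk : 0 < k) :
    MemLp ({x | |u x| ≤ k}.indicator fun x => A x (genGrad Ω u x))
      (ENNReal.ofReal (p / (p - 1))) (volume.restrict Ω) := by
  have h1 := hu.memLp_flux hp hΩo hΩ hk
  obtain ⟨s₀, _, hs₀⟩ := (isCompact_Icc (a := -k) (b := k)).exists_isMinOn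
    ⟨0, by constructor <;> linarith⟩ hbc.continuousOn
  have e : ({x | |u x| ≤ k}.indicator fun x => A x (genGrad Ω u x)) = fun x => (b (u x))⁻¹ •
      {x | |u x| ≤ k}.indicator (fun x => b (u x) • A x (genGrad Ω u x)) x := by
    ext1 x
    by_cases hux : x ∈ {x | |u x| ≤ k}
    · rw [indicator_of_mem hux, indicator_of_mem hux, smul_smul, inv_mul_cancel₀ (hb0 _).ne',
        one_smul]
    · rw [indicator_of_notMem hux, indicator_of_notMem hux, smul_zero]
  refine h1.of_le_mul (c := (b s₀)⁻¹) ?_ (Eventually.of_forall fun x => ?_)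
  · rw [e]
    exact (hbc.measurable.comp_aemeasurable hu.meas).inv.aestronglyMeasurable.smul
      h1.aestronglyMeasurable
  · by_cases hux : x ∈ {x | |u x| ≤ k}
    · rw [indicator_of_mem hux, indicator_of_mem hux, norm_smul, Real.norm_of_nonneg (hb0 _).le,
        ← mul_assoc]
      have h2 : b s₀ ≤ b (u x) := hs₀ (abs_le.1 hux)
      have h3 : 1 ≤ (b s₀)⁻¹ * b (u x) := by
        rw [inv_mul_eq_div, one_le_div (hb0 _)]
        exact h2
      exact le_mul_of_one_le_left (norm_nonneg _) h3
    · rw [indicator_of_notMem hux, indicator_of_notMem hux]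
      simp

theorem integrable_norm_mul_norm
    {X Y : EuclideanSpace ℝ (Fin N) → EuclideanSpace ℝ (Fin N)} (hp : 1 < p)
    (hX : MemLp X (ENNReal.ofReal (p / (p - 1))) (volume.restrict Ω))
    (hY : MemLp Y (ENNReal.ofReal p) (volume.restrict Ω)) :
    Integrable (fun x => ‖X x‖ * ‖Y x‖) (volume.restrict Ω) := by
  have : (ENNReal.ofReal (p / (p - 1))).HolderTriple (ENNReal.ofReal p) 1 :=
    (Real.HolderConjugate.conjExponent hp).symm.ennrealOfReal
  exact MemLp.integrable_mul (p := ENNReal.ofReal (p / (p - 1))) (q := ENNReal.ofReal p)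
    hX.norm hY.norm

/-- The truncation `T_n(v)` is an admissible test function. Where |u − T_n(v)| < k one has |u| ≤ n +
k, so only the flux and gradient on {|u| ≤ n + k} enter, and Hölder's inequality applies. -/
theorem IsEntropySolution.crossFlux_integrable_and_le
    (hu : IsEntropySolution Ω p (fun x s ξ => b s • A x ξ) h f u)
    (hv : IsEntropySolution Ω p (fun x s ξ => b s • A x ξ) h f v)
    (hp : 1 < p) (hΩo : IsOpen Ω) (hΩ : volume Ω ≠ ∞) {n k : ℝ} (hn : 0 < n) (hk : 0 < k) :
    Integrable (fun x => crossFlux (A x) b n k (u x) (v x) (genGrad Ω u x) (genGrad Ω v x))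
      (volume.restrict Ω) ∧
    ∫ x in Ω, crossFlux (A x) b n k (u x) (v x) (genGrad Ω u x) (genGrad Ω v x) ≤
      ∫ x in Ω, source h f u x * trunc k (u x - trunc n (v x)) := by
  have hG := hu.isGenGradient hp.le hΩo hΩ
  have hGv := hv.isGenGradient hp.le hΩo hΩ
  have hnk : 0 < n + k := by linarith
  have hw := hG.weakGrad_trunc_sub hp.le hΩo hΩ hu.trunc_mem
    (hGv.isTestLimit hp.le hΩo hΩ hn (hv.trunc_mem n hn)) hn (fun x => abs_trunc_le hn.le _) hk
  have hX := hu.memLp_flux hp.le hΩo hΩ hnk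
  have hY := (hG.memLp hp.le hΩo hΩ hnk (hu.trunc_mem _ hnk)).sub
    (hGv.memLp hp.le hΩo hΩ hn (hv.trunc_mem _ hn))
  have hset : NullMeasurableSet {x | |u x - trunc n (v x)| < k} (volume.restrict Ω) :=
    nullMeasurableSet_lt (continuous_abs.measurable.comp_aemeasurable
      (hu.meas.sub ((continuous_trunc n).measurable.comp_aemeasurable hv.meas))) aemeasurable_const
  have e : ∀ x, crossFlux (A x) b n k (u x) (v x) (genGrad Ω u x) (genGrad Ω v x) =
      {x | |u x - trunc n (v x)| < k}.indicator (fun x => inner ℝ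
        ({x | |u x| ≤ n + k}.indicator (fun x => b (u x) • A x (genGrad Ω u x)) x)
        ({x | |u x| ≤ n + k}.indicator (genGrad Ω u) x -
          {x | |v x| ≤ n}.indicator (genGrad Ω v) x)) x := by
    intro x
    unfold crossFlux
    by_cases hx : |u x - trunc n (v x)| < k
    · have m1 : x ∈ {x | |u x - trunc n (v x)| < k} := hx
      have h1 := abs_le.1 (abs_trunc_le hn.le (v x))
      have h2 := abs_lt.1 hx
      have h3 : |u x| ≤ n + k := abs_le.2 ⟨by linarith, by linarith⟩
      have m2 : x ∈ {x | |u x| ≤ n + k} := h3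
      rw [if_pos hx, indicator_of_mem m1, indicator_of_mem m2, indicator_of_mem m2]
      simp [indicator]
    · rw [if_neg hx, indicator_of_notMem (by exact hx)]
  have hi : Integrable (fun x => inner ℝ
        ({x | |u x| ≤ n + k}.indicator (fun x => b (u x) • A x (genGrad Ω u x)) x)
        ({x | |u x| ≤ n + k}.indicator (genGrad Ω u) x -
          {x | |v x| ≤ n}.indicator (genGrad Ω v) x)) (volume.restrict Ω) :=
    (integrable_norm_mul_norm hp hX hY).mono'
      (hX.aestronglyMeasurable.inner hY.aestronglyMeasurable)
      (Eventually.of_forall fun x => abs_real_inner_le_norm _ _)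
  refine ⟨(hi.indicator₀ hset).congr (Eventually.of_forall fun x => (e x).symm), ?_⟩
  refine le_trans (le_of_eq (integral_congr_ae ?_))
    (hu.entropy_ineq k hk _ (hv.trunc_mem n hn) (memLp_top_trunc hn.le hv.meas))
  filter_upwards [hw] with x hx
  rw [hx]
  unfold crossFlux
  by_cases hc : |u x - trunc n (v x)| < k
  · rw [if_pos hc, indicator_of_mem (by exact hc)]
    simp [indicator]
  · rw [if_neg hc, indicator_of_notMem (by exact hc), inner_zero_right]

theorem aemeasurable_comp_toNNReal (hh : Measurable h) (hu : AEMeasurable u (volume.restrict Ω)) :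
    AEMeasurable (fun x => h (u x).toNNReal) (volume.restrict Ω) :=
  hh.comp_aemeasurable (measurable_real_toNNReal.comp_aemeasurable hu)

theorem aestronglyMeasurable_source (hh : Measurable h) (hf : AEMeasurable f (volume.restrict Ω))
    (hu : AEMeasurable u (volume.restrict Ω)) :
    AEStronglyMeasurable (source h f u) (volume.restrict Ω) :=
  ((aemeasurable_comp_toNNReal hh hu).ennreal_toReal.mul hf).aestronglyMeasurable

section Source

variable {a : EuclideanSpace ℝ (Fin N) → ℝ → EuclideanSpace ℝ (Fin N) → EuclideanSpace ℝ (Fin N)}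

theorem IsEntropySolution.integrable_source_mul (hu : IsEntropySolution Ω p a h f u)
    (hh : Measurable h) (hf : AEMeasurable f (volume.restrict Ω)) {k : ℝ} (hk : 0 < k)
    {φ : EuclideanSpace ℝ (Fin N) → ℝ} (hφ : MemW01p Ω p φ)
    (hφi : MemLp φ ∞ (volume.restrict Ω)) :
    Integrable (fun x => source h f u x * trunc k (u x - φ x)) (volume.restrict Ω) := by
  have h1 := hu.source_mem k hk φ hφ hφi
  have mT : AEMeasurable (fun x => trunc k (u x - φ x)) (volume.restrict Ω) :=
    (continuous_trunc k).measurable.comp_aemeasurable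
      (hu.meas.sub hφi.aestronglyMeasurable.aemeasurable)
  have h2 : Integrable (fun x => (h (u x).toNNReal *
      ENNReal.ofReal |f x * trunc k (u x - φ x)|).toReal) (volume.restrict Ω) :=
    integrable_toReal_of_lintegral_ne_top ((aemeasurable_comp_toNNReal hh hu.meas).mul
      (continuous_abs.measurable.comp_aemeasurable (hf.mul mT)).ennreal_ofReal) h1.ne
  refine h2.mono ((aestronglyMeasurable_source hh hf hu.meas).mul mT.aestronglyMeasurable)
    (Eventually.of_forall fun x => le_of_eq ?_)
  rw [Real.norm_of_nonneg ENNReal.toReal_nonneg, ENNReal.toReal_mul,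
    ENNReal.toReal_ofReal (abs_nonneg _), source, mul_assoc, norm_mul,
    Real.norm_of_nonneg ENNReal.toReal_nonneg, Real.norm_eq_abs]

/-- The [0, ∞]-valued product h(u)|f T_1(u − φ)| has finite integral, hence is a.e. finite, and its
second factor is nonzero where u ≠ φ. -/
theorem IsEntropySolution.ae_ne_top (hu : IsEntropySolution Ω p a h f u)
    (hh : Measurable h) (hf : AEMeasurable f (volume.restrict Ω))
    (hf0 : ∀ᵐ x ∂(volume.restrict Ω), 0 < f x)
    {φ : EuclideanSpace ℝ (Fin N) → ℝ} (hφ : MemW01p Ω p φ)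
    (hφi : MemLp φ ∞ (volume.restrict Ω)) :
    ∀ᵐ x ∂(volume.restrict Ω), u x ≠ φ x → h (u x).toNNReal ≠ ∞ := by
  have h1 := hu.source_mem 1 one_pos φ hφ hφi
  have mT : AEMeasurable (fun x => trunc 1 (u x - φ x)) (volume.restrict Ω) :=
    (continuous_trunc 1).measurable.comp_aemeasurable
      (hu.meas.sub hφi.aestronglyMeasurable.aemeasurable)
  have h2 := ae_lt_top' ((aemeasurable_comp_toNNReal hh hu.meas).mul
      (continuous_abs.measurable.comp_aemeasurable (hf.mul mT)).ennreal_ofReal) h1.ne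
  filter_upwards [h2, hf0] with x hx hfx hne htop
  have hT : trunc 1 (u x - φ x) ≠ 0 := fun h0 => by
    have := trunc_of_abs_trunc_lt (k := 1) zero_le_one (by rw [h0]; simp)
    rw [trunc_of_abs_le this.le] at h0
    exact hne (sub_eq_zero.1 h0)
  simp only [Pi.mul_apply, Function.comp, htop] at hx
  rw [ENNReal.top_mul] at hx
  · exact hx.ne rfl
  · simpa using ⟨hfx.ne', hT⟩

theorem source_nonneg (hf0 : ∀ᵐ x ∂(volume.restrict Ω), 0 < f x) :
    ∀ᵐ x ∂(volume.restrict Ω), 0 ≤ source h f u x := by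
  filter_upwards [hf0] with x hx
  exact mul_nonneg ENNReal.toReal_nonneg hx.le

/-- The test function φ = 0 at height 1 gives this, since T_1(u) = 1 where u > n ≥ 1. -/
theorem IsEntropySolution.integrable_source_of_lt (hu : IsEntropySolution Ω p a h f u)
    (hh : Measurable h) (hf : AEMeasurable f (volume.restrict Ω)) {n : ℝ} (hn : 1 ≤ n) :
    Integrable (fun x => if n < u x then source h f u x else 0) (volume.restrict Ω) := by
  have h1 := hu.integrable_source_mul hh hf one_pos memW01p_zero MemLp.zero'
  refine (integrable_ite h1 (nullMeasurableSet_gt hu.meas n)).congr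
    (Eventually.of_forall fun x => ?_)
  simp only [sub_zero]
  split_ifs with hx
  · rw [trunc_of_le zero_le_one (by linarith), mul_one]
  · rfl

end Source

/-- Testing a solution with its own truncation: T_k(u − T_n(u)) has nonzero gradient only in the
strip. -/
theorem crossFlux_self {E : Type*} [NormedAddCommGroup E] [InnerProductSpace ℝ E] (a : E → E)
    (b : ℝ → ℝ) {n k s : ℝ} (hn : 0 ≤ n) (hs : 0 ≤ s) (ξ : E) :
    crossFlux a b n k s s ξ ξ = if n < s ∧ s < n + k then inner ℝ (b s • a ξ) ξ else 0 := by
  unfold crossFlux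
  rw [abs_of_nonneg hs]
  rcases le_or_gt s n with h | h
  · simp [h, not_lt.2 h]
  · rw [trunc_of_le hn h.le, if_neg (not_le.2 h), sub_zero, abs_of_nonneg (by linarith)]
    simp only [h, true_and, sub_lt_iff_lt_add']

/-- The energy estimate on the strip `{n < u < n + k}`. -/
theorem IsEntropySolution.energy
    (hu : IsEntropySolution Ω p (fun x s ξ => b s • A x ξ) h f u)
    (hp : 1 < p) (hΩo : IsOpen Ω) (hΩ : volume Ω ≠ ∞) (hh : Measurable h)
    (hf : AEMeasurable f (volume.restrict Ω)) (hf0 : ∀ᵐ x ∂(volume.restrict Ω), 0 < f x)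
    {n k : ℝ} (hn : 1 ≤ n) (hk : 0 < k) :
    Integrable (fun x => if n < u x ∧ u x < n + k then
      (inner ℝ (b (u x) • A x (genGrad Ω u x)) (genGrad Ω u x) : ℝ) else 0) (volume.restrict Ω) ∧
    ∫ x in Ω, (if n < u x ∧ u x < n + k then
      (inner ℝ (b (u x) • A x (genGrad Ω u x)) (genGrad Ω u x) : ℝ) else 0) ≤
      k * ∫ x in Ω, if n < u x then source h f u x else 0 := by
  have hn0 : 0 < n := by linarith
  obtain ⟨h1, h2⟩ := hu.crossFlux_integrable_and_le hu hp hΩo hΩ hn0 hk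
  have e : (fun x => crossFlux (A x) b n k (u x) (u x) (genGrad Ω u x) (genGrad Ω u x))
      =ᵐ[volume.restrict Ω] fun x => if n < u x ∧ u x < n + k then
      (inner ℝ (b (u x) • A x (genGrad Ω u x)) (genGrad Ω u x) : ℝ) else 0 := by
    filter_upwards [hu.nonneg] with x hx
    exact crossFlux_self _ _ hn0.le hx _
  refine ⟨h1.congr e, ?_⟩
  rw [← integral_congr_ae e]
  refine h2.trans ?_
  rw [← integral_const_mul]
  refine integral_mono_ae (hu.integrable_source_mul hh hf hk (hu.trunc_mem n hn0)
    (memLp_top_trunc hn0.le hu.meas)) ((hu.integrable_source_of_lt hh hf hn).const_mul k) ?_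
  filter_upwards [hu.nonneg, source_nonneg (h := h) (u := u) hf0] with x hx hs
  rcases le_or_gt (u x) n with hc | hc
  · rw [trunc_of_nonneg_of_le hx hc, sub_self, if_neg (not_lt.2 hc),
      trunc_of_abs_le (by simpa using hk.le)]
    simp
  · rw [if_pos hc, mul_comm]
    exact mul_le_mul_of_nonneg_right ((le_abs_self _).trans (abs_trunc_le hk.le _)) hs

end DegElliptic

/-! ### Integrals over layers, and the pointwise bound of the right-hand side. -/

namespace DegElliptic

variable {N : ℕ} {Ω : Set (EuclideanSpace ℝ (Fin N))}
  {p : ℝ} {A : EuclideanSpace ℝ (Fin N) → EuclideanSpace ℝ (Fin N) →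
  EuclideanSpace ℝ (Fin N)} {b : ℝ → ℝ} {h : ℝ≥0 → ℝ≥0∞}
  {f u v : EuclideanSpace ℝ (Fin N) → ℝ}

/-- The quantitative bounds on `A(x, ξ)` and `b(s)` that the uniqueness proof uses. -/
structure OperatorBounds (Ω : Set (EuclideanSpace ℝ (Fin N))) (p : ℝ)
    (A : EuclideanSpace ℝ (Fin N) → EuclideanSpace ℝ (Fin N) → EuclideanSpace ℝ (Fin N))
    (b : ℝ → ℝ) (β : ℝ) (l : EuclideanSpace ℝ (Fin N) → ℝ) (B L : ℝ) : Prop where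
  coercive : ∀ᵐ x ∂(volume.restrict Ω), ∀ ξ, ‖ξ‖ ^ p ≤ inner ℝ (A x ξ) ξ
  growth : ∀ᵐ x ∂(volume.restrict Ω), ∀ ξ, ‖A x ξ‖ ≤ β * (l x + ‖ξ‖ ^ (p - 1))
  monotone : ∀ᵐ x ∂(volume.restrict Ω), ∀ ξ η, 0 ≤ inner ℝ (A x ξ - A x η) (ξ - η)
  growth_const_nonneg : 0 ≤ β
  growth_nonneg : ∀ᵐ x ∂(volume.restrict Ω), 0 ≤ l x
  growth_integrable : Integrable (fun x => l x ^ (p / (p - 1))) (volume.restrict Ω)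
  pos : ∀ s, 0 < b s
  le_bound : ∀ s, b s ≤ B
  lip_nonneg : 0 ≤ L
  lipschitz : ∀ s t, |b s - b t| ≤ L * |s - t|
  continuous : Continuous b

/-- The integral of `F` over `{r < u}`. -/
noncomputable def upperTail (Ω : Set (EuclideanSpace ℝ (Fin N))) (u F : EuclideanSpace ℝ (Fin N) → ℝ)
    (r : ℝ) : ℝ :=
  ∫ x in Ω, if r < u x then F x else 0

/-- The integral of `|∇u|^p` over `{u ≤ r}`. -/
noncomputable def gradEnergy (Ω : Set (EuclideanSpace ℝ (Fin N))) (p : ℝ) (u : EuclideanSpace ℝ (Fin N) → ℝ)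
    (r : ℝ) : ℝ :=
  ∫ x in Ω, if u x ≤ r then ‖genGrad Ω u x‖ ^ p else 0

theorem upperTail_nonneg {F : EuclideanSpace ℝ (Fin N) → ℝ}
    (hF : ∀ᵐ x ∂(volume.restrict Ω), 0 ≤ F x) (r : ℝ) : 0 ≤ upperTail Ω u F r := by
  refine integral_nonneg_of_ae ?_
  filter_upwards [hF] with x hx
  simp only [Pi.zero_apply]
  split_ifs <;> simp [hx]

theorem upperTail_anti {F : EuclideanSpace ℝ (Fin N) → ℝ}
    (hF : ∀ᵐ x ∂(volume.restrict Ω), 0 ≤ F x) (hu : AEMeasurable u (volume.restrict Ω))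
    {r r' : ℝ} (hi : Integrable (fun x => if r < u x then F x else 0) (volume.restrict Ω))
    (hr : r ≤ r') : upperTail Ω u F r' ≤ upperTail Ω u F r := by
  have e : (fun x => if r' < u x then (if r < u x then F x else 0) else 0) =
      fun x => if r' < u x then F x else 0 := by
    ext1 x
    by_cases hx : r' < u x
    · simp [hx, hr.trans_lt hx]
    · simp [hx]
  have h2 := integrable_ite hi (nullMeasurableSet_gt hu r')
  rw [e] at h2
  refine integral_mono_ae h2 hi ?_
  filter_upwards [hF] with x hx
  by_cases hx' : r' < u x
  · simp [hx', hr.trans_lt hx']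
  · simp only [if_neg hx']
    split_ifs <;> simp [hx]

theorem tendsto_upperTail {F : EuclideanSpace ℝ (Fin N) → ℝ}
    (hu : AEMeasurable u (volume.restrict Ω)) {r : ℝ}
    (hi : Integrable (fun x => if r < u x then F x else 0) (volume.restrict Ω)) :
    Tendsto (fun n : ℕ => upperTail Ω u F (r + n)) atTop (𝓝 0) := by
  have hle : ∀ n : ℕ, r ≤ r + n := fun n => by simp
  have e : ∀ n : ℕ, (fun x => if r + n < u x then (if r < u x then F x else 0) else 0) =
      fun x => if r + n < u x then F x else 0 := fun n => by
    ext1 x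
    by_cases hx : r + n < u x
    · simp [hx, (hle n).trans_lt hx]
    · simp [hx]
  have h0 : (0 : ℝ) = ∫ x in Ω, (fun _ => (0 : ℝ)) x := by simp
  rw [h0]
  refine tendsto_integral_of_dominated_convergence _ (fun n => ?_) hi.norm (fun n => ?_) ?_
  · rw [← e n]
    exact (integrable_ite hi (nullMeasurableSet_gt hu _)).aestronglyMeasurable
  · refine Eventually.of_forall fun x => ?_
    by_cases hx : r + n < u x
    · simp [hx, (hle n).trans_lt hx]
    · simp [hx]
  · refine Eventually.of_forall fun x => ?_
    refine tendsto_const_nhds.congr' ?_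
    filter_upwards [eventually_ge_atTop ⌈u x - r⌉₊] with n hn
    have : u x - r ≤ n := (Nat.le_ceil _).trans (by exact_mod_cast hn)
    rw [if_neg (by linarith)]

theorem IsEntropySolution.integrable_gradEnergy
    {a : EuclideanSpace ℝ (Fin N) → ℝ → EuclideanSpace ℝ (Fin N) → EuclideanSpace ℝ (Fin N)}
    (hu : IsEntropySolution Ω p a h f u) (hp : 1 < p) (hΩo : IsOpen Ω) (hΩ : volume Ω ≠ ∞)
    {r : ℝ} (hr : 0 < r) :
    Integrable (fun x => if u x ≤ r then ‖genGrad Ω u x‖ ^ p else 0) (volume.restrict Ω) := by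
  have h1 := (hu.isGenGradient hp.le hΩo hΩ).memLp hp.le hΩo hΩ hr (hu.trunc_mem r hr)
  have h2 := h1.integrable_norm_rpow (by simpa using by linarith) ENNReal.ofReal_ne_top
  rw [ENNReal.toReal_ofReal (by linarith)] at h2
  refine h2.congr ?_
  filter_upwards [hu.nonneg] with x hx
  by_cases hxr : u x ≤ r
  · have m : x ∈ {x | |u x| ≤ r} := by
      have : |u x| ≤ r := by rwa [abs_of_nonneg hx]
      exact this
    rw [if_pos hxr, indicator_of_mem m]
  · have m : x ∉ {x | |u x| ≤ r} := by
      have : ¬ |u x| ≤ r := by rwa [abs_of_nonneg hx]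
      exact this
    rw [if_neg hxr, indicator_of_notMem m, norm_zero, Real.zero_rpow (by linarith)]

theorem gradEnergy_nonneg (r : ℝ) : 0 ≤ gradEnergy Ω p u r :=
  integral_nonneg fun x => by
    simp only [Pi.zero_apply]
    split_ifs <;> positivity

/-- The ℓ-term and the gradient term are bounded by differences between neighbouring levels, which
telescope when summed. The energy term is already of order k. -/
theorem IsEntropySolution.integral_layerTerm_le
    (hu : IsEntropySolution Ω p (fun x s ξ => b s • A x ξ) h f u)
    (hp : 1 < p) (hΩo : IsOpen Ω) (hΩ : volume Ω ≠ ∞) (hh : Measurable h)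
    (hf : AEMeasurable f (volume.restrict Ω)) (hf0 : ∀ᵐ x ∂(volume.restrict Ω), 0 < f x)
    {β B L C : ℝ} {l : EuclideanSpace ℝ (Fin N) → ℝ} (hO : OperatorBounds Ω p A b β l B L)
    (hC : 0 ≤ C) {n k : ℝ} (hk : 0 < k) (hn : 1 ≤ n - k) :
    Integrable (fun x => layerTerm (A x) b p (p / (p - 1)) (l x) B L C n k (u x) (genGrad Ω u x))
      (volume.restrict Ω) ∧
    ∫ x in Ω, layerTerm (A x) b p (p / (p - 1)) (l x) B L C n k (u x) (genGrad Ω u x) ≤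
      C * B * (upperTail Ω u (fun x => l x ^ (p / (p - 1))) n -
        upperTail Ω u (fun x => l x ^ (p / (p - 1))) (n + k)) +
      (C + 1) * ((2 * k) * upperTail Ω u (source h f u) (n - k)) +
      L * k * (gradEnergy Ω p u n - gradEnergy Ω p u (n - k)) := by
  have hB : 0 ≤ B := (hO.pos 0).le.trans (hO.le_bound 0)
  have iF : ∀ r, Integrable (fun x => if r < u x then l x ^ (p / (p - 1)) else 0)
      (volume.restrict Ω) := fun r =>
    integrable_ite hO.growth_integrable (nullMeasurableSet_gt hu.meas r)
  -- The strip around n has base n − k and width 2k.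
  obtain ⟨iE, hE⟩ := hu.energy hp hΩo hΩ hh hf hf0 hn (by linarith : 0 < 2 * k)
  rw [show n - k + 2 * k = n + k by ring] at iE hE
  have iQ : ∀ r, 0 < r → Integrable (fun x => if u x ≤ r then ‖genGrad Ω u x‖ ^ p else 0)
      (volume.restrict Ω) := fun r hr => hu.integrable_gradEnergy hp hΩo hΩ hr
  have i1 : Integrable (fun x => if n < u x ∧ u x < n + k then C * B * l x ^ (p / (p - 1)) else 0)
      (volume.restrict Ω) :=
    integrable_ite (hO.growth_integrable.const_mul _)
      ((nullMeasurableSet_gt hu.meas n).inter (nullMeasurableSet_lt hu.meas aemeasurable_const))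
  have i2 : Integrable (fun x => if n - k < u x ∧ u x < n + k then (C + 1) *
      (inner ℝ (b (u x) • A x (genGrad Ω u x)) (genGrad Ω u x) : ℝ) else 0)
      (volume.restrict Ω) :=
    (iE.const_mul (C + 1)).congr (Eventually.of_forall fun x => by
      simp only [mul_ite, mul_zero])
  have i3 : Integrable (fun x => L * k * (if n - k < u x ∧ u x ≤ n then
      ‖genGrad Ω u x‖ ^ p else 0)) (volume.restrict Ω) := by
    refine Integrable.const_mul ?_ _
    refine (integrable_ite (iQ n (by linarith)) (nullMeasurableSet_gt hu.meas (n - k))).congr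
      (Eventually.of_forall fun x => ?_)
    simp only [ite_and]
  have e1 : ∫ x in Ω, (if n < u x ∧ u x < n + k then C * B * l x ^ (p / (p - 1)) else 0) ≤
      C * B * (upperTail Ω u (fun x => l x ^ (p / (p - 1))) n -
        upperTail Ω u (fun x => l x ^ (p / (p - 1))) (n + k)) := by
    unfold upperTail
    rw [← integral_sub (iF _) (iF _), ← integral_const_mul]
    refine integral_mono_ae i1 (((iF _).sub (iF _)).const_mul _) ?_
    filter_upwards [hO.growth_nonneg] with x hx
    have hlq : 0 ≤ l x ^ (p / (p - 1)) := by positivity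
    by_cases c1 : n < u x
    · by_cases c2 : u x < n + k
      · simp [c1, c2, not_lt.2 c2.le]
      · rw [if_neg (fun h => c2 h.2), if_pos c1]
        refine mul_nonneg (by positivity) (sub_nonneg.2 ?_)
        split_ifs <;> simp [hlq]
    · simp [c1, not_lt.2 ((not_lt.1 c1).trans (by linarith : n ≤ n + k))]
  have e2 : ∫ x in Ω, (if n - k < u x ∧ u x < n + k then (C + 1) *
      (inner ℝ (b (u x) • A x (genGrad Ω u x)) (genGrad Ω u x) : ℝ) else 0) ≤
      (C + 1) * ((2 * k) * upperTail Ω u (source h f u) (n - k)) := by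
    calc _ = (C + 1) * ∫ x in Ω, (if n - k < u x ∧ u x < n + k then
        (inner ℝ (b (u x) • A x (genGrad Ω u x)) (genGrad Ω u x) : ℝ) else 0) := by
          rw [← integral_const_mul]
          simp only [mul_ite, mul_zero]
      _ ≤ _ := mul_le_mul_of_nonneg_left hE (by linarith)
  have e3 : ∫ x in Ω, L * k * (if n - k < u x ∧ u x ≤ n then ‖genGrad Ω u x‖ ^ p else 0) =
      L * k * (gradEnergy Ω p u n - gradEnergy Ω p u (n - k)) := by
    unfold gradEnergy
    rw [integral_const_mul, ← integral_sub (iQ _ (by linarith)) (iQ _ (by linarith))]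
    congr 1
    refine integral_congr_ae (Eventually.of_forall fun x => ?_)
    simp only
    by_cases c1 : n - k < u x
    · simp [c1, not_le.2 c1]
    · have c2 : u x ≤ n - k := not_lt.1 c1
      have c3 : u x ≤ n := c2.trans (by linarith)
      simp [c2, c3, not_lt.2 c2]
  refine ⟨(i1.add i2).add i3, ?_⟩
  refine le_trans (le_of_eq ((integral_add (i1.add i2) i3).trans
    (congrArg₂ (· + ·) (integral_add i1 i2) e3))) ?_
  linarith

/-- Below n the left-hand side is (Hs − Ht) T_k(s − t) ≤ 0, equal to −k|Hs − Ht| once |s − t| ≥ k₀ ≥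
k; since M ≤ n, the gap set lies there. If exactly one argument exceeds n, the source at the lower
one gets a nonpositive factor, and the other contributes at most k times itself. -/
theorem source_cross_le {s t n k k₀ M Hs Ht : ℝ} (hs : 0 ≤ s) (ht : 0 ≤ t) (hn : 0 ≤ n)
    (hk : 0 ≤ k) (hkk : k ≤ k₀) (hMn : M ≤ n) (hHs : 0 ≤ Hs) (hHt : 0 ≤ Ht)
    (hanti : (Hs - Ht) * (s - t) ≤ 0) :
    Hs * trunc k (s - trunc n t) + Ht * trunc k (t - trunc n s) ≤
      k * ((if n < s then Hs else 0) + (if n < t then Ht else 0)) -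
        k * (if (s ≤ M ∧ t ≤ M) ∧ k₀ ≤ |s - t| then |Hs - Ht| else 0) := by
  have hub : ∀ r, trunc k r ≤ k := fun r => (le_abs_self _).trans (abs_trunc_le hk r)
  have hneg : ∀ r, r ≤ 0 → trunc k r ≤ 0 := fun r hr => by
    unfold trunc
    exact max_le (by linarith) ((min_le_left _ _).trans hr)
  rcases le_or_gt s n with hsn | hsn <;> rcases le_or_gt t n with htn | htn
  · rw [trunc_of_nonneg_of_le ht htn, trunc_of_nonneg_of_le hs hsn, if_neg (not_lt.2 hsn),
      if_neg (not_lt.2 htn)]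
    have hodd : trunc k (t - s) = - trunc k (s - t) := by
      rw [trunc_eq_abs k _ hk, trunc_eq_abs k _ hk, show t - s + k = -(s - t - k) by ring,
        show t - s - k = -(s - t + k) by ring, abs_neg, abs_neg]
      ring
    rw [hodd]
    have h1 : Hs * trunc k (s - t) + Ht * -trunc k (s - t) = (Hs - Ht) * trunc k (s - t) := by
      ring
    rw [h1]
    rcases lt_trichotomy s t with hst | hst | hst
    · have h2 : 0 ≤ Hs - Ht := by nlinarith
      split_ifs with hc
      · rw [abs_of_neg (by linarith)] at hc
        rw [trunc_of_le_neg hk (by linarith), abs_of_nonneg h2]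
        linarith
      · have := mul_nonpos_of_nonneg_of_nonpos h2 (hneg (s - t) (by linarith))
        linarith
    · subst hst
      split_ifs with hc
      · simp only [sub_self, abs_zero] at hc
        have : k = 0 := le_antisymm (hkk.trans hc.2) hk
        simp [this, trunc]
      · simp [trunc, hk]
    · have h2 : Hs - Ht ≤ 0 := by nlinarith
      split_ifs with hc
      · rw [abs_of_pos (by linarith)] at hc
        rw [trunc_of_le hk (by linarith), abs_of_nonpos h2]
        linarith
      · have h3 : 0 ≤ trunc k (s - t) := by
          have := hneg (t - s) (by linarith)
          linarith
        have := mul_nonpos_of_nonpos_of_nonneg h2 h3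
        linarith
  · rw [trunc_of_le hn htn.le, if_neg (not_lt.2 hsn), if_pos htn,
      if_neg (fun h => absurd (h.1.2.trans hMn) (not_le.2 htn))]
    have h1 := mul_nonpos_of_nonneg_of_nonpos hHs (hneg (s - n) (by linarith))
    have h2 := mul_le_mul_of_nonneg_left (hub (t - trunc n s)) hHt
    linarith
  · rw [trunc_of_le hn hsn.le, if_neg (not_lt.2 htn), if_pos hsn,
      if_neg (fun h => absurd (h.1.1.trans hMn) (not_le.2 hsn))]
    have h1 := mul_nonpos_of_nonneg_of_nonpos hHt (hneg (t - n) (by linarith))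
    have h2 := mul_le_mul_of_nonneg_left (hub (s - trunc n t)) hHs
    linarith
  · rw [if_pos htn, if_pos hsn,
      if_neg (fun h => absurd (h.1.1.trans hMn) (not_le.2 hsn))]
    have h1 := mul_le_mul_of_nonneg_left (hub (s - trunc n t)) hHs
    have h2 := mul_le_mul_of_nonneg_left (hub (t - trunc n s)) hHt
    linarith

end DegElliptic

/-! ### Comparison of two solutions and averaging over levels. -/

namespace DegElliptic

variable {N : ℕ} {Ω : Set (EuclideanSpace ℝ (Fin N))}
  {p : ℝ} {A : EuclideanSpace ℝ (Fin N) → EuclideanSpace ℝ (Fin N) →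
  EuclideanSpace ℝ (Fin N)} {b : ℝ → ℝ} {h : ℝ≥0 → ℝ≥0∞}
  {f u v : EuclideanSpace ℝ (Fin N) → ℝ}

/-- `|h(u) f - h(v) f|` on the set where `u` and `v` are at most `M` and at least `k` apart. -/
noncomputable def sourceGap (h : ℝ≥0 → ℝ≥0∞) (f u v : EuclideanSpace ℝ (Fin N) → ℝ) (M k : ℝ)
    (x : EuclideanSpace ℝ (Fin N)) : ℝ :=
  if (u x ≤ M ∧ v x ≤ M) ∧ k ≤ |u x - v x| then |source h f u x - source h f v x| else 0

/-- `|A(x, ∇v)| (|∇u| + |∇v|)` on the set where `u` and `v` are at most `M`, different, and less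
than `k` apart. -/
noncomputable def closeFlux (Ω : Set (EuclideanSpace ℝ (Fin N)))
    (A : EuclideanSpace ℝ (Fin N) → EuclideanSpace ℝ (Fin N) → EuclideanSpace ℝ (Fin N))
    (u v : EuclideanSpace ℝ (Fin N) → ℝ) (M k : ℝ) (x : EuclideanSpace ℝ (Fin N)) : ℝ :=
  if (u x ≤ M ∧ v x ≤ M) ∧ u x ≠ v x ∧ |u x - v x| < k then
    ‖A x (genGrad Ω v x)‖ * (‖genGrad Ω u x‖ + ‖genGrad Ω v x‖) else 0

/-- `toReal` sends ∞ to 0, so strict monotonicity survives only where the larger value of h is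
finite. Finiteness on {u ≠ v} comes from `ae_ne_top` with the truncations of the other solution,
each value being left unchanged by a large enough one. -/
theorem IsEntropySolution.source_sub_mul_sub_neg
    {a : EuclideanSpace ℝ (Fin N) → ℝ → EuclideanSpace ℝ (Fin N) → EuclideanSpace ℝ (Fin N)}
    (hu : IsEntropySolution Ω p a h f u) (hv : IsEntropySolution Ω p a h f v)
    (hh : StrictAnti h) (hf : AEMeasurable f (volume.restrict Ω))
    (hf0 : ∀ᵐ x ∂(volume.restrict Ω), 0 < f x) :
    ∀ᵐ x ∂(volume.restrict Ω), u x ≠ v x →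
      (source h f u x - source h f v x) * (u x - v x) < 0 := by
  have hm : Measurable h := hh.antitone.measurable
  have hpos : ∀ n : ℕ, (0 : ℝ) < n + 1 := fun n => by positivity
  have h1 : ∀ᵐ x ∂(volume.restrict Ω), ∀ n : ℕ, u x ≠ trunc (n + 1) (v x) →
      h (u x).toNNReal ≠ ∞ := ae_all_iff.2 fun n =>
    hu.ae_ne_top hm hf hf0 (hv.trunc_mem _ (hpos n)) (memLp_top_trunc (hpos n).le hv.meas)
  have h2 : ∀ᵐ x ∂(volume.restrict Ω), ∀ n : ℕ, v x ≠ trunc (n + 1) (u x) →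
      h (v x).toNNReal ≠ ∞ := ae_all_iff.2 fun n =>
    hv.ae_ne_top hm hf hf0 (hu.trunc_mem _ (hpos n)) (memLp_top_trunc (hpos n).le hu.meas)
  have key : ∀ s t : ℝ, 0 ≤ s → s < t → h s.toNNReal ≠ ∞ →
      (h t.toNNReal).toReal < (h s.toNNReal).toReal := fun s t hs hst hfin =>
    ENNReal.toReal_strict_mono hfin (hh ((Real.toNNReal_lt_toNNReal_iff (hs.trans_lt hst)).2 hst))
  filter_upwards [h1, h2, hu.nonneg, hv.nonneg, hf0] with x h1 h2 hux hvx hfx hne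
  have ht : ∀ s : ℝ, trunc ((⌈|s|⌉₊ : ℝ) + 1) s = s := fun s =>
    trunc_of_abs_le ((Nat.le_ceil _).trans (by linarith))
  have f1 := h1 ⌈|v x|⌉₊ (by rwa [ht])
  have f2 := h2 ⌈|u x|⌉₊ (by rw [ht]; exact hne.symm)
  unfold source
  rcases lt_or_gt_of_ne hne with hlt | hlt
  · have := key _ _ hux hlt f1
    exact mul_neg_of_pos_of_neg (sub_pos.2 (mul_lt_mul_of_pos_right this hfx)) (sub_neg.2 hlt)
  · have := key _ _ hvx hlt f2
    exact mul_neg_of_neg_of_pos (sub_neg.2 (mul_lt_mul_of_pos_right this hfx)) (sub_pos.2 hlt)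

theorem nullMeasurableSet_abs_sub_lt (hu : AEMeasurable u (volume.restrict Ω))
    (hv : AEMeasurable v (volume.restrict Ω)) (k : ℝ) :
    NullMeasurableSet {x | |u x - v x| < k} (volume.restrict Ω) :=
  nullMeasurableSet_lt (continuous_abs.measurable.comp_aemeasurable (hu.sub hv)) aemeasurable_const

theorem nullMeasurableSet_le_abs_sub (hu : AEMeasurable u (volume.restrict Ω))
    (hv : AEMeasurable v (volume.restrict Ω)) (k : ℝ) :
    NullMeasurableSet {x | k ≤ |u x - v x|} (volume.restrict Ω) :=
  nullMeasurableSet_le aemeasurable_const (continuous_abs.measurable.comp_aemeasurable (hu.sub hv))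

/-- On the set in question T_k(u − v) = ±k, so the two integrable source terms, tested with
truncations at M, add up to ±k(h(u)f − h(v)f). -/
theorem IsEntropySolution.integrable_sourceGap
    {a : EuclideanSpace ℝ (Fin N) → ℝ → EuclideanSpace ℝ (Fin N) → EuclideanSpace ℝ (Fin N)}
    (hu : IsEntropySolution Ω p a h f u) (hv : IsEntropySolution Ω p a h f v)
    (hh : Measurable h) (hf : AEMeasurable f (volume.restrict Ω)) {M k : ℝ} (hM : 0 < M)
    (hk : 0 < k) : Integrable (sourceGap h f u v M k) (volume.restrict Ω) := by
  have i1 := hu.integrable_source_mul hh hf hk (hv.trunc_mem M hM) (memLp_top_trunc hM.le hv.meas)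
  have i2 := hv.integrable_source_mul hh hf hk (hu.trunc_mem M hM) (memLp_top_trunc hM.le hu.meas)
  have i3 := integrable_ite (P := fun x => (u x ≤ M ∧ v x ≤ M) ∧ k ≤ |u x - v x|) ((i1.add i2).abs.const_mul k⁻¹)
    (((nullMeasurableSet_le_const hu.meas M).inter (nullMeasurableSet_le_const hv.meas M)).inter
      (nullMeasurableSet_le_abs_sub hu.meas hv.meas k))
  refine i3.congr ?_
  filter_upwards [hu.nonneg, hv.nonneg] with x hux hvx
  unfold sourceGap
  refine ite_congr rfl (fun hc => ?_) fun _ => rfl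
  simp only [Pi.add_apply]
  rw [trunc_of_nonneg_of_le hux hc.1.1, trunc_of_nonneg_of_le hvx hc.1.2]
  have hk' : k⁻¹ * (k * |source h f u x - source h f v x|) =
    |source h f u x - source h f v x| := inv_mul_cancel_left₀ hk.ne' _
  rw [← hk']
  congr 1
  rcases le_abs'.1 hc.2 with h1 | h1
  · rw [trunc_of_le_neg hk.le h1, trunc_of_le hk.le (by linarith),
      show source h f u x * -k + source h f v x * k =
        -k * (source h f u x - source h f v x) by ring, abs_mul, abs_neg, abs_of_pos hk]
  · rw [trunc_of_le hk.le h1, trunc_of_le_neg hk.le (by linarith),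
      show source h f u x * k + source h f v x * -k =
        k * (source h f u x - source h f v x) by ring, abs_mul, abs_of_pos hk]

/-- A majorant of `closeFlux` that does not depend on k. -/
theorem IsEntropySolution.integrable_fluxProduct
    (hu : IsEntropySolution Ω p (fun x s ξ => b s • A x ξ) h f u)
    (hv : IsEntropySolution Ω p (fun x s ξ => b s • A x ξ) h f v)
    (hp : 1 < p) (hΩo : IsOpen Ω) (hΩ : volume Ω ≠ ∞) (hbc : Continuous b) (hb0 : ∀ s, 0 < b s)
    {M : ℝ} (hM : 0 < M) :
    Integrable (fun x => if u x ≤ M ∧ v x ≤ M then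
      ‖A x (genGrad Ω v x)‖ * (‖genGrad Ω u x‖ + ‖genGrad Ω v x‖) else 0)
      (volume.restrict Ω) := by
  have hX := hv.memLp_operator hp.le hΩo hΩ hbc hb0 hM
  have hU := (hu.isGenGradient hp.le hΩo hΩ).memLp hp.le hΩo hΩ hM (hu.trunc_mem M hM)
  have hV := (hv.isGenGradient hp.le hΩo hΩ).memLp hp.le hΩo hΩ hM (hv.trunc_mem M hM)
  have i1 := (integrable_norm_mul_norm hp hX hU).add (integrable_norm_mul_norm hp hX hV)
  have i2 := integrable_ite (P := fun x => u x ≤ M ∧ v x ≤ M) i1 ((nullMeasurableSet_le_const hu.meas M).inter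
    (nullMeasurableSet_le_const hv.meas M))
  refine i2.congr ?_
  filter_upwards [hu.nonneg, hv.nonneg] with x hux hvx
  refine ite_congr rfl (fun hc => ?_) fun _ => rfl
  have m1 : x ∈ {x | |u x| ≤ M} := by
    have : |u x| ≤ M := by rw [abs_of_nonneg hux]; exact hc.1
    exact this
  have m2 : x ∈ {x | |v x| ≤ M} := by
    have : |v x| ≤ M := by rw [abs_of_nonneg hvx]; exact hc.2
    exact this
  simp only [Pi.add_apply]
  rw [indicator_of_mem m1, indicator_of_mem m2, indicator_of_mem m2]
  ring

theorem IsEntropySolution.integrable_closeFlux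
    (hu : IsEntropySolution Ω p (fun x s ξ => b s • A x ξ) h f u)
    (hv : IsEntropySolution Ω p (fun x s ξ => b s • A x ξ) h f v)
    (hp : 1 < p) (hΩo : IsOpen Ω) (hΩ : volume Ω ≠ ∞) (hbc : Continuous b) (hb0 : ∀ s, 0 < b s)
    {M : ℝ} (hM : 0 < M) (k : ℝ) :
    Integrable (closeFlux Ω A u v M k) (volume.restrict Ω) := by
  have i2 := integrable_ite (P := fun x => u x ≠ v x ∧ |u x - v x| < k)
    (hu.integrable_fluxProduct hv hp hΩo hΩ hbc hb0 hM)
    ((nullMeasurableSet_eq_fun hu.meas hv.meas).compl.inter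
      (nullMeasurableSet_abs_sub_lt hu.meas hv.meas k))
  refine i2.congr (Eventually.of_forall fun x => ?_)
  unfold closeFlux
  by_cases c1 : u x ≤ M ∧ v x ≤ M
  · simp [c1]
  · simp [c1]

/-- The sets {0 < |u − v| < 1/(j + 1)} shrink to ∅. -/
theorem IsEntropySolution.tendsto_integral_closeFlux
    (hu : IsEntropySolution Ω p (fun x s ξ => b s • A x ξ) h f u)
    (hv : IsEntropySolution Ω p (fun x s ξ => b s • A x ξ) h f v)
    (hp : 1 < p) (hΩo : IsOpen Ω) (hΩ : volume Ω ≠ ∞) (hbc : Continuous b) (hb0 : ∀ s, 0 < b s)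
    {M : ℝ} (hM : 0 < M) :
    Tendsto (fun j : ℕ => ∫ x in Ω, closeFlux Ω A u v M (1 / ((j : ℝ) + 1)) x) atTop (𝓝 0) := by
  have h0 : (0 : ℝ) = ∫ x in Ω, (fun _ => (0 : ℝ)) x := by simp
  rw [h0]
  refine tendsto_integral_of_dominated_convergence _
    (fun n => (hu.integrable_closeFlux hv hp hΩo hΩ hbc hb0 hM _).aestronglyMeasurable)
    (hu.integrable_fluxProduct hv hp hΩo hΩ hbc hb0 hM)
    (fun n => Eventually.of_forall fun x => ?_) (Eventually.of_forall fun x => ?_)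
  · unfold closeFlux
    have : 0 ≤ ‖A x (genGrad Ω v x)‖ * (‖genGrad Ω u x‖ + ‖genGrad Ω v x‖) := by positivity
    by_cases c1 : u x ≤ M ∧ v x ≤ M
    · rw [if_pos c1]
      split_ifs
      · rw [Real.norm_of_nonneg this]
      · simpa using this
    · rw [if_neg c1, if_neg (fun h => c1 h.1), norm_zero]
  · refine tendsto_const_nhds.congr' ?_
    by_cases hne : u x = v x
    · exact Eventually.of_forall fun n => by simp [closeFlux, hne]
    · have hpos : 0 < |u x - v x| := abs_pos.2 (sub_ne_zero.2 hne)
      filter_upwards [tendsto_inv_nat_succ.eventually_lt_const hpos] with n hn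
      rw [closeFlux, if_neg (fun h => absurd h.2.2 (not_lt.2 hn.le))]

/-- The comparison of two entropy solutions at the level `n`, with the width `k`. -/
theorem IsEntropySolution.integral_sourceGap_le_of_level
    (hu : IsEntropySolution Ω p (fun x s ξ => b s • A x ξ) h f u)
    (hv : IsEntropySolution Ω p (fun x s ξ => b s • A x ξ) h f v)
    (hp : 1 < p) (hΩo : IsOpen Ω) (hΩ : volume Ω ≠ ∞) (hh : StrictAnti h)
    (hf : AEMeasurable f (volume.restrict Ω)) (hf0 : ∀ᵐ x ∂(volume.restrict Ω), 0 < f x)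
    {β B L : ℝ} {l : EuclideanSpace ℝ (Fin N) → ℝ} (hO : OperatorBounds Ω p A b β l B L)
    {M M' k₀ n k : ℝ} (hM : 0 < M) (hk : 0 < k) (hkk : k ≤ k₀) (hn : 1 ≤ n - k) (hMn : M ≤ n)
    (hnM : n ≤ M') :
    k * ∫ x in Ω, sourceGap h f u v M k₀ x ≤
      k * (upperTail Ω u (source h f u) n + upperTail Ω v (source h f v) n) +
      L * k * (∫ x in Ω, closeFlux Ω A u v M' k x) +
      ((∫ x in Ω, layerTerm (A x) b p (p / (p - 1)) (l x) B L ((2 * β) ^ (p / (p - 1))) n k (u x)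
        (genGrad Ω u x)) +
      ∫ x in Ω, layerTerm (A x) b p (p / (p - 1)) (l x) B L ((2 * β) ^ (p / (p - 1))) n k (v x)
        (genGrad Ω v x)) := by
  have hm : Measurable h := hh.antitone.measurable
  have hn1 : 1 ≤ n := by linarith
  have hn0 : 0 < n := by linarith
  have hpq : (p / (p - 1)).HolderConjugate p := (Real.HolderConjugate.conjExponent hp).symm
  have hC : 0 ≤ (2 * β) ^ (p / (p - 1)) :=
    Real.rpow_nonneg (by linarith [hO.growth_const_nonneg]) _
  obtain ⟨c1, c1'⟩ := hu.crossFlux_integrable_and_le hv hp hΩo hΩ hn0 hk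
  obtain ⟨c2, c2'⟩ := hv.crossFlux_integrable_and_le hu hp hΩo hΩ hn0 hk
  have l1 := (hu.integral_layerTerm_le hp hΩo hΩ hm hf hf0 hO hC hk hn).1
  have l2 := (hv.integral_layerTerm_le hp hΩo hΩ hm hf hf0 hO hC hk hn).1
  have d := hu.integrable_closeFlux hv hp hΩo hΩ hO.continuous hO.pos (M := M') (by linarith) k
  have s1 := hu.integrable_source_mul hm hf hk (hv.trunc_mem n hn0)
    (memLp_top_trunc hn0.le hv.meas)
  have s2 := hv.integrable_source_mul hm hf hk (hu.trunc_mem n hn0)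
    (memLp_top_trunc hn0.le hu.meas)
  have t1 := hu.integrable_source_of_lt hm hf hn1
  have t2 := hv.integrable_source_of_lt hm hf hn1
  have z := hu.integrable_sourceGap hv hm hf hM (hk.trans_le hkk)
  have hL : -(L * k * (∫ x in Ω, closeFlux Ω A u v M' k x) +
      ((∫ x in Ω, layerTerm (A x) b p (p / (p - 1)) (l x) B L ((2 * β) ^ (p / (p - 1))) n k (u x)
        (genGrad Ω u x)) +
      ∫ x in Ω, layerTerm (A x) b p (p / (p - 1)) (l x) B L ((2 * β) ^ (p / (p - 1))) n k (v x)
        (genGrad Ω v x))) ≤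
      (∫ x in Ω, crossFlux (A x) b n k (u x) (v x) (genGrad Ω u x) (genGrad Ω v x)) +
      ∫ x in Ω, crossFlux (A x) b n k (v x) (u x) (genGrad Ω v x) (genGrad Ω u x) := by
    have l12 := l1.add l2
    simp only [Pi.add_def] at l12
    rw [← integral_const_mul, ← integral_add l1 l2, ← integral_add (d.const_mul _) l12,
      ← integral_neg, ← integral_add c1 c2]
    refine integral_mono_ae ((d.const_mul _).add l12).neg (c1.add c2) ?_
    filter_upwards [hO.coercive, hO.growth, hO.monotone, hO.growth_nonneg, hu.nonneg, hv.nonneg]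
      with x h1 h2 h3 h4 h5 h6
    exact crossFlux_add_crossFlux_ge hpq hO.growth_const_nonneg h4 h2 h1 h3
      (fun s => (hO.pos s).le) hO.le_bound hO.lip_nonneg hO.lipschitz hk.le h5 h6 hnM _ _
  have hR : (∫ x in Ω, source h f u x * trunc k (u x - trunc n (v x))) +
      ∫ x in Ω, source h f v x * trunc k (v x - trunc n (u x)) ≤
      k * (upperTail Ω u (source h f u) n + upperTail Ω v (source h f v) n) -
        k * ∫ x in Ω, sourceGap h f u v M k₀ x := by
    have t12 : Integrable (fun x => (if n < u x then source h f u x else 0) +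
        if n < v x then source h f v x else 0) (volume.restrict Ω) := t1.add t2
    unfold upperTail
    rw [← integral_add s1 s2, ← integral_add t1 t2, ← integral_const_mul, ← integral_const_mul,
      ← integral_sub (t12.const_mul k) (z.const_mul k)]
    refine integral_mono_ae (s1.add s2) ((t12.const_mul k).sub (z.const_mul k)) ?_
    filter_upwards [hu.nonneg, hv.nonneg, source_nonneg (h := h) (u := u) hf0,
      source_nonneg (h := h) (u := v) hf0, hu.source_sub_mul_sub_neg hv hh hf hf0]
      with x h1 h2 h3 h4 h5
    refine source_cross_le h1 h2 hn0.le hk.le hkk hMn h3 h4 ?_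
    by_cases hne : u x = v x
    · simp [hne]
    · exact (h5 hne).le
  linarith

theorem sum_range_shift_sub_le {F : ℝ → ℝ} (h0 : ∀ r, 0 ≤ F r) (hF : Antitone F) (r k : ℝ) (hk : 0 ≤ k)
    (J : ℕ) :
    ∑ i ∈ Finset.range J, (F (r + (i + 1) * k) - F (r + (i + 1) * k + k)) ≤ F r := by
  have h1 := Finset.sum_range_sub' (fun i : ℕ => F (r + (i + 1) * k)) J
  have e : ∀ i : ℕ, r + (i + 1) * k + k = r + ((i + 1 : ℕ) + 1 : ℝ) * k := fun i => by
    push_cast; ring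
  simp_rw [e, h1]
  have h2 := h0 (r + ((J : ℝ) + 1) * k)
  have h3 : F (r + (((0 : ℕ) : ℝ) + 1) * k) ≤ F r := hF (by simp [hk])
  linarith

/-- The comparison of two entropy solutions, averaged over the levels in `[n, n + 1]`. -/
theorem IsEntropySolution.integral_sourceGap_le
    (hu : IsEntropySolution Ω p (fun x s ξ => b s • A x ξ) h f u)
    (hv : IsEntropySolution Ω p (fun x s ξ => b s • A x ξ) h f v)
    (hp : 1 < p) (hΩo : IsOpen Ω) (hΩ : volume Ω ≠ ∞) (hh : StrictAnti h)
    (hf : AEMeasurable f (volume.restrict Ω)) (hf0 : ∀ᵐ x ∂(volume.restrict Ω), 0 < f x)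
    {β B L : ℝ} {l : EuclideanSpace ℝ (Fin N) → ℝ} (hO : OperatorBounds Ω p A b β l B L)
    {M k₀ n : ℝ} (hM : 0 < M) (hn : 1 ≤ n) (hMn : M ≤ n) {j : ℕ} (hj : 1 / ((j : ℝ) + 1) ≤ k₀) :
    ∫ x in Ω, sourceGap h f u v M k₀ x ≤
      (1 + 2 * ((2 * β) ^ (p / (p - 1)) + 1)) *
        (upperTail Ω u (source h f u) n + upperTail Ω v (source h f v) n) +
      (2 * β) ^ (p / (p - 1)) * B * (upperTail Ω u (fun x => l x ^ (p / (p - 1))) n +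
        upperTail Ω v (fun x => l x ^ (p / (p - 1))) n) +
      (L * (∫ x in Ω, closeFlux Ω A u v (n + 1) (1 / ((j : ℝ) + 1)) x) +
      L * (1 / ((j : ℝ) + 1)) * (gradEnergy Ω p u (n + 1) + gradEnergy Ω p v (n + 1))) := by
  have hm : Measurable h := hh.antitone.measurable
  set k : ℝ := 1 / ((j : ℝ) + 1) with hkdef
  set C : ℝ := (2 * β) ^ (p / (p - 1)) with hCdef
  have hj0 : (0 : ℝ) < (j : ℝ) + 1 := by positivity
  have hk : 0 < k := by positivity
  have hJk : ((j : ℝ) + 1) * k = 1 := by rw [hkdef]; field_simp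
  have hC : 0 ≤ C := Real.rpow_nonneg (by linarith [hO.growth_const_nonneg]) _
  have hB : 0 ≤ B := (hO.pos 0).le.trans (hO.le_bound 0)
  have hL := hO.lip_nonneg
  have hlq : ∀ᵐ x ∂(volume.restrict Ω), 0 ≤ l x ^ (p / (p - 1)) := by
    filter_upwards [hO.growth_nonneg] with x hx
    positivity
  have hs : ∀ w : EuclideanSpace ℝ (Fin N) → ℝ,
      IsEntropySolution Ω p (fun x s ξ => b s • A x ξ) h f w → ∀ r, n ≤ r →
      upperTail Ω w (source h f w) r ≤ upperTail Ω w (source h f w) n := fun w hw r hr =>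
    upperTail_anti (source_nonneg hf0) hw.meas (hw.integrable_source_of_lt hm hf hn) hr
  have hF : ∀ w : EuclideanSpace ℝ (Fin N) → ℝ,
      IsEntropySolution Ω p (fun x s ξ => b s • A x ξ) h f w →
      Antitone (upperTail Ω w (fun x => l x ^ (p / (p - 1)))) := fun w hw r r' hr =>
    upperTail_anti hlq hw.meas
      (integrable_ite hO.growth_integrable (nullMeasurableSet_gt hw.meas r)) hr
  -- The j + 1 levels are n + k, …, n + 1. All their strips start at or above n, and since (j + 1)k
  -- = 1, summing over the levels replaces division by k.
  have hlev : ∀ i ∈ Finset.range (j + 1), n ≤ n + ((i : ℝ) + 1) * k - k ∧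
      n + ((i : ℝ) + 1) * k ≤ n + 1 := fun i hi => by
    have h1 : (i : ℝ) + 1 ≤ (j : ℝ) + 1 := by exact_mod_cast Finset.mem_range.1 hi
    have h2 : 0 ≤ (i : ℝ) * k := by positivity
    have h3 := mul_le_mul_of_nonneg_right h1 hk.le
    constructor <;> nlinarith
  have hlayer : ∀ w : EuclideanSpace ℝ (Fin N) → ℝ,
      IsEntropySolution Ω p (fun x s ξ => b s • A x ξ) h f w →
      ∑ i ∈ Finset.range (j + 1), (∫ x in Ω, layerTerm (A x) b p (p / (p - 1)) (l x) B L C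
        (n + ((i : ℝ) + 1) * k) k (w x) (genGrad Ω w x)) ≤
      C * B * upperTail Ω w (fun x => l x ^ (p / (p - 1))) n +
        2 * (C + 1) * upperTail Ω w (source h f w) n +
        L * k * gradEnergy Ω p w (n + 1) := fun w hw => by
    have h1 : ∀ i ∈ Finset.range (j + 1), (∫ x in Ω, layerTerm (A x) b p (p / (p - 1)) (l x) B L C
        (n + ((i : ℝ) + 1) * k) k (w x) (genGrad Ω w x)) ≤
        C * B * (upperTail Ω w (fun x => l x ^ (p / (p - 1))) (n + ((i : ℝ) + 1) * k) -
          upperTail Ω w (fun x => l x ^ (p / (p - 1))) (n + ((i : ℝ) + 1) * k + k)) +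
        (C + 1) * ((2 * k) * upperTail Ω w (source h f w) n) +
        L * k * (gradEnergy Ω p w (n + ((i + 1 : ℕ) : ℝ) * k) -
          gradEnergy Ω p w (n + (i : ℝ) * k)) := fun i hi => by
      obtain ⟨h2, h3⟩ := hlev i hi
      have h4 := (hw.integral_layerTerm_le hp hΩo hΩ hm hf hf0 hO hC hk (hn.trans h2)).2
      have h5 : (C + 1) * ((2 * k) * upperTail Ω w (source h f w) (n + ((i : ℝ) + 1) * k - k)) ≤
          (C + 1) * ((2 * k) * upperTail Ω w (source h f w) n) := by
        have := hs w hw _ h2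
        gcongr
      rw [show n + (i : ℝ) * k = n + ((i : ℝ) + 1) * k - k by ring, Nat.cast_add_one]
      linarith
    -- The ℓ and gradient terms telescope; the energy terms add up with the factor (j + 1)·2k = 2.
    refine (Finset.sum_le_sum h1).trans ?_
    rw [Finset.sum_add_distrib, Finset.sum_add_distrib, ← Finset.mul_sum, Finset.sum_const,
      ← Finset.mul_sum, Finset.sum_range_sub (fun i : ℕ => gradEnergy Ω p w (n + (i : ℝ) * k)),
      Finset.card_range, nsmul_eq_mul, Nat.cast_add_one, hJk]
    have h6 := sum_range_shift_sub_le (F := upperTail Ω w (fun x => l x ^ (p / (p - 1))))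
      (upperTail_nonneg hlq) (hF w hw) n k hk.le (j + 1)
    have h7 := mul_le_mul_of_nonneg_left h6 (mul_nonneg hC hB)
    have h8 : 0 ≤ L * k * gradEnergy Ω p w n :=
      mul_nonneg (mul_nonneg hL hk.le) (gradEnergy_nonneg _)
    have h9 : ((j : ℝ) + 1) * ((C + 1) * (2 * k * upperTail Ω w (source h f w) n)) =
        2 * (C + 1) * upperTail Ω w (source h f w) n := by
      calc _ = (((j : ℝ) + 1) * k) * (2 * (C + 1) * upperTail Ω w (source h f w) n) := by ring
        _ = _ := by rw [hJk, one_mul]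
    rw [h9, Nat.cast_zero, zero_mul, add_zero]
    linarith
  have hsum : ∑ i ∈ Finset.range (j + 1), k * ∫ x in Ω, sourceGap h f u v M k₀ x ≤
      ∑ i ∈ Finset.range (j + 1),
        (k * (upperTail Ω u (source h f u) n + upperTail Ω v (source h f v) n +
          L * ∫ x in Ω, closeFlux Ω A u v (n + 1) k x) +
        ((∫ x in Ω, layerTerm (A x) b p (p / (p - 1)) (l x) B L C (n + ((i : ℝ) + 1) * k) k (u x)
          (genGrad Ω u x)) +
        ∫ x in Ω, layerTerm (A x) b p (p / (p - 1)) (l x) B L C (n + ((i : ℝ) + 1) * k) k (v x)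
          (genGrad Ω v x))) := by
    refine Finset.sum_le_sum fun i hi => ?_
    obtain ⟨h2, h3⟩ := hlev i hi
    have h4 := hu.integral_sourceGap_le_of_level hv hp hΩo hΩ hh hf hf0 hO hM hk hj
      (hn.trans h2) (by linarith) h3
    have h5 : k * (upperTail Ω u (source h f u) (n + ((i : ℝ) + 1) * k) +
        upperTail Ω v (source h f v) (n + ((i : ℝ) + 1) * k)) ≤
        k * (upperTail Ω u (source h f u) n + upperTail Ω v (source h f v) n) :=
      mul_le_mul_of_nonneg_left
        (add_le_add (hs u hu _ (by linarith)) (hs v hv _ (by linarith))) hk.le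
    linarith
  rw [Finset.sum_const, Finset.card_range, nsmul_eq_mul, Nat.cast_add_one, ← mul_assoc, hJk,
    one_mul, Finset.sum_add_distrib, Finset.sum_add_distrib, Finset.sum_const, Finset.card_range,
    nsmul_eq_mul, Nat.cast_add_one, ← mul_assoc, hJk, one_mul] at hsum
  have := hlayer u hu
  have := hlayer v hv
  linarith

/-- Two entropy solutions agree almost everywhere. The summability of `h(u) f` away from `{u = 0}`,
which is part of the definition, and the Lipschitz continuity of `b` are enough: since `b(u)` and
`b(v)` differ by at most `L k` where `|u - v| < k`, no lower bound on the decay of `b` is used. -/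
theorem IsEntropySolution.ae_eq
    (hu : IsEntropySolution Ω p (fun x s ξ => b s • A x ξ) h f u)
    (hv : IsEntropySolution Ω p (fun x s ξ => b s • A x ξ) h f v)
    (hp : 1 < p) (hΩo : IsOpen Ω) (hΩ : volume Ω ≠ ∞) (hh : StrictAnti h)
    (hf : AEMeasurable f (volume.restrict Ω)) (hf0 : ∀ᵐ x ∂(volume.restrict Ω), 0 < f x)
    {β B L : ℝ} {l : EuclideanSpace ℝ (Fin N) → ℝ} (hO : OperatorBounds Ω p A b β l B L) :
    u =ᵐ[volume.restrict Ω] v := by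
  have hm : Measurable h := hh.antitone.measurable
  have hgap0 : ∀ M k : ℝ, ∀ x, 0 ≤ sourceGap h f u v M k x := fun M k x => by
    unfold sourceGap
    split_ifs <;> positivity
  have hzero : ∀ M k₀ : ℝ, 1 ≤ M → 0 < k₀ → ∫ x in Ω, sourceGap h f u v M k₀ x = 0 := by
    intro M k₀ hM hk₀
    refine le_antisymm ?_ (integral_nonneg (hgap0 M k₀))
    have hM0 : 0 < M := by linarith
    -- The level M + i stays fixed while the spacing 1/(j + 1) tends to 0, which removes both terms
    -- that carry L.
    have hlim : ∀ i : ℕ, ∫ x in Ω, sourceGap h f u v M k₀ x ≤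
        (1 + 2 * ((2 * β) ^ (p / (p - 1)) + 1)) *
          (upperTail Ω u (source h f u) (M + i) + upperTail Ω v (source h f v) (M + i)) +
        (2 * β) ^ (p / (p - 1)) * B * (upperTail Ω u (fun x => l x ^ (p / (p - 1))) (M + i) +
          upperTail Ω v (fun x => l x ^ (p / (p - 1))) (M + i)) := by
      intro i
      have hi : (0 : ℝ) ≤ i := by positivity
      have t1 := ((hu.tendsto_integral_closeFlux hv hp hΩo hΩ hO.continuous hO.pos
        (M := M + i + 1) (by linarith)).const_mul L).add
        ((tendsto_inv_nat_succ.const_mul L).mul_const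
          (gradEnergy Ω p u (M + i + 1) + gradEnergy Ω p v (M + i + 1)))
      rw [mul_zero, zero_mul, add_zero] at t1
      have t2 := t1.const_add ((1 + 2 * ((2 * β) ^ (p / (p - 1)) + 1)) *
          (upperTail Ω u (source h f u) (M + i) + upperTail Ω v (source h f v) (M + i)) +
        (2 * β) ^ (p / (p - 1)) * B * (upperTail Ω u (fun x => l x ^ (p / (p - 1))) (M + i) +
          upperTail Ω v (fun x => l x ^ (p / (p - 1))) (M + i)))
      rw [add_zero] at t2
      refine ge_of_tendsto t2 ?_
      filter_upwards [tendsto_inv_nat_succ.eventually_le_const hk₀] with j hj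
      exact hu.integral_sourceGap_le (n := M + i) hv hp hΩo hΩ hh hf hf0 hO hM0 (by linarith)
        (by linarith) hj
    have hs : ∀ w : EuclideanSpace ℝ (Fin N) → ℝ,
        IsEntropySolution Ω p (fun x s ξ => b s • A x ξ) h f w →
        Tendsto (fun i : ℕ => upperTail Ω w (source h f w) (M + i)) atTop (𝓝 0) := fun w hw =>
      tendsto_upperTail hw.meas (hw.integrable_source_of_lt hm hf hM)
    have hl : ∀ w : EuclideanSpace ℝ (Fin N) → ℝ,
        IsEntropySolution Ω p (fun x s ξ => b s • A x ξ) h f w →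
        Tendsto (fun i : ℕ => upperTail Ω w (fun x => l x ^ (p / (p - 1))) (M + i)) atTop
          (𝓝 0) := fun w hw =>
      tendsto_upperTail hw.meas
        (integrable_ite hO.growth_integrable (nullMeasurableSet_gt hw.meas M))
    -- Now the level tends to infinity, and only tails of integrable functions remain.
    have t := (((hs u hu).add (hs v hv)).const_mul (1 + 2 * ((2 * β) ^ (p / (p - 1)) + 1))).add
      (((hl u hu).add (hl v hv)).const_mul ((2 * β) ^ (p / (p - 1)) * B))
    simp only [add_zero, mul_zero] at t
    exact ge_of_tendsto' t hlim
  -- Countably many bounds and separations exhaust {u ≠ v}, so a single null set suffices.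
  have hae : ∀ᵐ x ∂(volume.restrict Ω), ∀ i j : ℕ,
      sourceGap h f u v ((i : ℝ) + 1) (1 / ((j : ℝ) + 1)) x = 0 := by
    rw [ae_all_iff]; intro i; rw [ae_all_iff]; intro j
    have hi : (1 : ℝ) ≤ (i : ℝ) + 1 := by simp
    have hj : 0 < 1 / ((j : ℝ) + 1) := by positivity
    exact (integral_eq_zero_iff_of_nonneg (hgap0 _ _)
      (hu.integrable_sourceGap hv hm hf (by linarith) hj)).1 (hzero _ _ hi hj)
  filter_upwards [hae, hu.source_sub_mul_sub_neg hv hh hf hf0] with x h1 h2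
  by_contra hne
  have h3 := h2 hne
  obtain ⟨i, hi⟩ := exists_nat_ge (max (u x) (v x))
  obtain ⟨j, hj⟩ := exists_nat_one_div_lt (abs_pos.2 (sub_ne_zero.2 hne))
  have h4 := h1 i j
  have h5 : u x ≤ (i : ℝ) + 1 := by linarith [le_max_left (u x) (v x)]
  have h6 : v x ≤ (i : ℝ) + 1 := by linarith [le_max_right (u x) (v x)]
  rw [sourceGap, if_pos ⟨⟨h5, h6⟩, hj.le⟩, abs_eq_zero] at h4
  rw [h4, zero_mul] at h3
  exact h3.false

/-- The structure conditions on `A` and `b` give the bounds of the uniqueness proof. -/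
theorem IsLerayLions.exists_operatorBounds (hA : IsLerayLions Ω p A) (hp : 1 < p)
    (hb_bdd : ∃ B : ℝ, ∀ s, |b s| ≤ B) (hb_lip : ∃ L : ℝ≥0, LipschitzWith L b)
    (hb : ∀ s, 0 < b s) :
    ∃ β l B L, OperatorBounds Ω p A b β l B L := by
  obtain ⟨β, hβ, l, hl0, hlq, hgr⟩ := hA.growth
  obtain ⟨B, hB⟩ := hb_bdd
  obtain ⟨L, hL⟩ := hb_lip
  have hq : 0 < p / (p - 1) := div_pos (by linarith) (by linarith)
  refine ⟨β, l, B, L, ⟨hA.coercive, hgr, ?_, hβ.le, hl0, ?_, hb, fun s => (le_abs_self _).trans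
    (hB s), L.2, fun s t => ?_, hL.continuous⟩⟩
  · filter_upwards [hA.strict_mono] with x hx ξ η
    by_cases hne : ξ = η
    · simp [hne]
    · exact (hx ξ η hne).le
  · have h1 := hlq.integrable_norm_rpow (by simpa using hq) ENNReal.ofReal_ne_top
    rw [ENNReal.toReal_ofReal hq.le] at h1
    refine h1.congr ?_
    filter_upwards [hl0] with x hx
    rw [Real.norm_of_nonneg hx]
  · have := hL.dist_le_mul s t
    rwa [Real.dist_eq, Real.dist_eq] at this

end DegElliptic

theorem theorem3p5
    (N : ℕ) (hN : 2 ≤ N)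
    (Ω : Set (EuclideanSpace ℝ (Fin N))) (hΩ_open : IsOpen Ω) (hΩ_bdd : Bornology.IsBounded Ω)
    (p : ℝ) (hp : 1 < p) (hpN : p < N)
    -- the operator `a(x, s, ξ) = A(x, ξ) b(s)`
    (A : EuclideanSpace ℝ (Fin N) → EuclideanSpace ℝ (Fin N) → EuclideanSpace ℝ (Fin N))
    (hA : DegElliptic.IsLerayLions Ω p A)
    (b : ℝ → ℝ) (hb_bdd : ∃ B : ℝ, ∀ s, |b s| ≤ B) (hb_lip : ∃ L : ℝ≥0, LipschitzWith L b)
    (α θ : ℝ) (hα : 0 < α) (hθ : 0 ≤ θ)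
    (hb : ∀ s : ℝ, α / (1 + |s|) ^ (θ * (p - 1)) ≤ b s)
    -- the lower order term
    (h : ℝ≥0 → ℝ≥0∞) (hh_cont : ContinuousOn h (Set.Ioi 0)) (hh_fin : ∀ s, 0 < s → h s ≠ ∞)
    (hh_decr : StrictAnti h)
    (γ₂ c₂ s₂ : ℝ) (hγ₂ : 0 ≤ γ₂) (hc₂ : 0 < c₂) (hs₂ : 0 < s₂)
    (hh_infty : ∀ s : ℝ≥0, s₂ ≤ (s : ℝ) → h s ≤ ENNReal.ofReal (c₂ / (s : ℝ) ^ γ₂))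
    -- the datum
    (m : ℝ) (hm : 1 ≤ m) (f : EuclideanSpace ℝ (Fin N) → ℝ)
    (hf : MemLp f (ENNReal.ofReal m) (volume.restrict Ω))
    (hf_pos : ∀ᵐ x ∂(volume.restrict Ω), 0 < f x) :
    (θ ≤ γ₂ / (p - 1) → m = 1 →
      ∀ u v : EuclideanSpace ℝ (Fin N) → ℝ,
        DegElliptic.IsEntropySolution Ω p (fun x s ξ => b s • A x ξ) h f u →
        DegElliptic.IsEntropySolution Ω p (fun x s ξ => b s • A x ξ) h f v →
        u =ᵐ[volume.restrict Ω] v) ∧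
    (γ₂ / (p - 1) < θ → 1 < m →
      ∀ u v : EuclideanSpace ℝ (Fin N) → ℝ,
        DegElliptic.IsEntropySolution Ω p (fun x s ξ => b s • A x ξ) h f u →
        Integrable (fun x => u x ^ (m * (θ * (p - 1) - γ₂) / (m - 1))) (volume.restrict Ω) →
        DegElliptic.IsEntropySolution Ω p (fun x s ξ => b s • A x ξ) h f v →
        Integrable (fun x => v x ^ (m * (θ * (p - 1) - γ₂) / (m - 1))) (volume.restrict Ω) →
        u =ᵐ[volume.restrict Ω] v) ∧
    (θ ≤ 1 + γ₂ / (p - 1) →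
      max (N * (p - 1) / ((N - p) * (γ₂ - θ * (p - 1)) + N * (p - 1))) 1 ≤ m →
      ∀ u v : EuclideanSpace ℝ (Fin N) → ℝ,
        DegElliptic.IsEntropySolution Ω p (fun x s ξ => b s • A x ξ) h f u →
        DegElliptic.IsEntropySolution Ω p (fun x s ξ => b s • A x ξ) h f v →
        u =ᵐ[volume.restrict Ω] v) := by
  have hb0 : ∀ s, 0 < b s := fun s => (by positivity : 0 < α / (1 + |s|) ^ (θ * (p - 1))).trans_le
    (hb s)
  obtain ⟨β, l, B, L, hO⟩ := hA.exists_operatorBounds hp hb_bdd hb_lip hb0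
  have key : ∀ u v : EuclideanSpace ℝ (Fin N) → ℝ,
      DegElliptic.IsEntropySolution Ω p (fun x s ξ => b s • A x ξ) h f u →
      DegElliptic.IsEntropySolution Ω p (fun x s ξ => b s • A x ξ) h f v →
      u =ᵐ[volume.restrict Ω] v := fun u v hu hv =>
    hu.ae_eq hv hp hΩ_open hΩ_bdd.measure_lt_top.ne hh_decr hf.aestronglyMeasurable.aemeasurable
      hf_pos hO
  exact ⟨fun _ _ => key, fun _ _ u v hu _ hv _ => key u v hu hv, fun _ _ => key⟩
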